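/- For $\omega\in\mathbb R\setminus\{0\}$ let \[ Q(\omega)=\frac{\tfrac14\,\log\log\pi}{|\omega|\,\bigl(1+|\omega|^2/4\pi^2\bigr)^{1/4}\,\log\bigl(\pi+|\omega|^{-1/2}\bigr)\,\bigl(\log\log(\pi+|\omega|^{-1/2})\bigr)^2}, \qquad R(x)=\frac{2\pi}{x\,\bigl(1+(x/2\pi)^{2}\bigr)\,Q(x)}, \] (the values at the single point $0$ are immaterial; set them to $0$). With the Fourier transform $\hat g(\omega)=\int_{\mathbb R}g(t)e^{-2\pi i\omega t}\,dt$, let $k(t,t')=\hat Q(t-t')$. Then the following hold. 1. $Q$ is nonnegative, even, integrable on $\mathbb R$, and strictly positive on $\mathbb R\setminus\{0\}$; $R$ is integrable on $\mathbb R$ and nonincreasing on $(0,\infty)$. 2. $k$ is a real-valued, positive semidefinite, translation invariant and universal kernel on $\mathbb R$ (universal: for every compact $K\subset\mathbb R$, finite linear combinations of the functions $k(s,\cdot)$, $s\in K$, are uniformly dense in $C(K)$), and $k(t,t)\le 8\pi^2$ for all $t\in\mathbb R$. 3. Let $\mathcal H$ be the reproducing kernel Hilbert space of real functions on $\mathbb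 R$ with kernel $k$. Every compactly supported, twice differentiable $f:\mathbb R\to\mathbb R$ with bounded $f''$ belongs to $\mathcal H$, and $\|f\|_{\mathcal H}^2=\int_{\mathbb R}|\hat f(\omega)|^2/Q(\omega)\,d\omega$. 4. There is a constant $0\le c\le(2\pi e)^2$ such that for every real $T>2$ and every twice differentiable $f:\mathbb R\to\mathbb R$ supported in $[0,T+1]$, \[ \|f\|_{\mathcal H}^2\le c^2\,\|f'\|_{L^1}\,\|f-f''\|_{L^\infty}\,\bigl(\ln(1+T)\,\ln\ln(1+T)\bigr)^2, \] and the same bound holds for $\int_{\mathbb R}|\hat f|^2/Q$ (both sides take values in $[0,\infty]$; $\|f\|_{\mathcal H}=\infty$ if $f\notin\mathcal H$). -/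

import Mathlib

open MeasureTheory
open scoped ENNReal FourierTransform

noncomputable section

/-- The explicit spectral density
`Q(ω) = (1/4) log log π / (|ω| (1 + |ω|²/4π²)^{1/4} log(π + |ω|^{-1/2}) (log log(π + |ω|^{-1/2}))²)`
(its value at the single point `ω = 0`, where the formula is singular, is immaterial). -/
def horizonFreeDensity (ω : ℝ) : ℝ :=
  (1 / 4 * Real.log (Real.log Real.pi)) /
    (|ω| * (1 + |ω| ^ 2 / (4 * Real.pi ^ 2)) ^ (1 / 4 : ℝ)
      * Real.log (Real.pi + |ω| ^ (-1 / 2 : ℝ))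
      * Real.log (Real.log (Real.pi + |ω| ^ (-1 / 2 : ℝ))) ^ 2)

/-- The function `R(x) = 2π / (x (1 + (x/2π)^{2m}) Q(x))` attached to a density `Q` and an
order `m`. -/
def densityRatio (Q : ℝ → ℝ) (m : ℕ) (x : ℝ) : ℝ :=
  2 * Real.pi / (x * (1 + (x / (2 * Real.pi)) ^ (2 * m)) * Q x)

/-- The Fourier transform `Q̂(s - t) = ∫ Q(ω) e^{-2πiω(s - t)} dω`, a priori complex valued. -/
def spectralKernelC (Q : ℝ → ℝ) (s t : ℝ) : ℂ :=
  𝓕 (fun ω : ℝ => (Q ω : ℂ)) (s - t)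

/-- The kernel with spectral density `Q` as a real-valued function. -/
def spectralKernel (Q : ℝ → ℝ) (s t : ℝ) : ℝ :=
  (spectralKernelC Q s t).re

/-- The squared norm `∫ |f̂(ω)|² / Q(ω) dω`, with value `∞` if the integral diverges. -/
def spectralNormSq (Q : ℝ → ℝ) (f : ℝ → ℝ) : ℝ≥0∞ :=
  ∫⁻ ω : ℝ, ENNReal.ofReal (‖𝓕 (fun t : ℝ => (f t : ℂ)) ω‖ ^ 2 / Q ω)

/-- Invariance of a kernel under simultaneous translation of its arguments. -/
def IsTranslationInvariant (k : ℝ → ℝ → ℝ) : Prop :=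
  ∀ s t h : ℝ, k (s + h) (t + h) = k s t

/-- Universality: on each compact `K`, every continuous function is a uniform limit of finite
linear combinations of the kernel sections `k s` with centres `s ∈ K`. -/
def IsUniversalKernel (k : ℝ → ℝ → ℝ) : Prop :=
  ∀ K : Set ℝ, IsCompact K → ∀ φ : ℝ → ℝ, ContinuousOn φ K → ∀ ε : ℝ, 0 < ε →
    ∃ a : ℝ →₀ ℝ, (a.support : Set ℝ) ⊆ K ∧
      ∀ t ∈ K, |φ t - a.sum (fun s b => b * k s t)| < ε

/-- `H` is the reproducing kernel Hilbert space of real-valued functions on `ℝ` with kernel `k`. -/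
def HasReproducingKernel (H : Type*) [NormedAddCommGroup H] [InnerProductSpace ℝ H]
    [CompleteSpace H] [RKHS ℝ H ℝ ℝ] (k : ℝ → ℝ → ℝ) : Prop :=
  ∀ s t : ℝ, RKHS.kernel H s t 1 = k s t

/-- The squared norm in `H` of a function `f : ℝ → ℝ`, with value `∞` if `f` does not belong
to `H`; the infimum ranges over at most one element. -/
def rkhsNormSq (H : Type*) [NormedAddCommGroup H] [InnerProductSpace ℝ H]
    [RKHS ℝ H ℝ ℝ] (f : ℝ → ℝ) : ℝ≥0∞ :=
  ⨅ (g : H) (_ : (⇑g : ℝ → ℝ) = f), ENNReal.ofReal (‖g‖ ^ 2)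

/-- `f` is twice differentiable on the whole line (the second derivative need not be
continuous). -/
def TwiceDifferentiable (f : ℝ → ℝ) : Prop :=
  Differentiable ℝ f ∧ Differentiable ℝ (deriv f)

end

/-! ### Real and imaginary parts of Fourier transforms of real functions -/

/-! Kernel side. With `cas = cos + sin`, the vectors `√Q · cas (t ·)` in real `L²` have Gram matrix
`k`, because the sine cross term is odd and `Q` is even. Their span is dense, by injectivity of the
Fourier transform (`dense_span_feature`). A continuous integrable `f` with `∫ |f̂|²/Q < ∞` is
represented by its Hartley transform divided by `√Q`, whose `L²` norm is the spectral norm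
(`exists_representer`). Equality of Gram matrices carries this to any RKHS with kernel `k`
(`exists_rkhs_of_representer`). Universality follows by projecting the representer of a cut-off
polynomial onto the features centred in `K`.

Norm bound. The transforms of `f'` and `f - f''` are `2πiω f̂` and `(1 + 4π²ω²) f̂`. Hence `|f̂|²/Q`
is, up to `1/(2π)`, the odd weight `V = dualWeight Q` times `Im` of the first transform times the
conjugate of the second. Fubini turns the spectral norm into a double integral of `f'(y) (f -
f'')(x) S(x - y)`, where `S` is the sine transform of `V` (`spectralNormSq_eq`). For `f` supported
in `[0, a]` it is therefore at most `‖f'‖₁ ‖f - f''‖_∞ ∫_{-a}^{a} |S| / (2π)`.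

Since `V` is nonincreasing on `(0, ∞)`, `S` is nonnegative on `[0, ∞)`, so `∫ |S|` is computed
exactly as an integral of `V` against `(1 - cos 2πaω)/(2πω)` (`integral_abs_sineTransform`).
Splitting at `1/a` and `1`, the weight contributes its size `log a (log log a)²` at `1/a`, and `∫
dω/ω` over `[1/a, 1]` contributes another `log a` (`integral_dualWeight_le`). The squared log log in
`Q` is what keeps `Q` integrable at `0`: there it is dominated by the derivative of `1 / log log (π
+ x^{-1/2})`. -/

lemma integrable_mul_cos {f : ℝ → ℝ} (hf : Integrable f) (c : ℝ) :
    Integrable (fun t => f t * Real.cos (c * t)) := by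
  refine hf.mul_bdd (c := 1) (by fun_prop) (Filter.Eventually.of_forall fun t => ?_)
  simpa using Real.abs_cos_le_one _

lemma integrable_mul_sin {f : ℝ → ℝ} (hf : Integrable f) (c : ℝ) :
    Integrable (fun t => f t * Real.sin (c * t)) := by
  refine hf.mul_bdd (c := 1) (by fun_prop) (Filter.Eventually.of_forall fun t => ?_)
  simpa using Real.abs_sin_le_one _

lemma integral_eq_zero_of_odd {f : ℝ → ℝ} (h : ∀ x, f (-x) = -f x) : ∫ x, f x = 0 := by
  have h1 := integral_neg_eq_self f volume
  simp only [h, integral_neg] at h1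
  linarith

lemma integrable_exp_smul {f : ℝ → ℝ} (hf : Integrable f) (w : ℝ) :
    Integrable fun v : ℝ => Complex.exp (↑(-2 * Real.pi * v * w) * Complex.I) • (f v : ℂ) := by
  refine hf.ofReal.bdd_mul (c := 1) (by fun_prop) (Filter.Eventually.of_forall fun t => ?_)
  rw [Complex.norm_exp_ofReal_mul_I]

lemma fourier_ofReal_re {f : ℝ → ℝ} (hf : Integrable f) (w : ℝ) :
    (𝓕 (fun t : ℝ => (f t : ℂ)) w).re = ∫ t, f t * Real.cos (2 * Real.pi * w * t) := by
  rw [Real.fourier_real_eq_integral_exp_smul]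
  refine (integral_re (integrable_exp_smul hf w)).symm.trans (integral_congr_ae ?_)
  refine Filter.Eventually.of_forall fun t => ?_
  have : -2 * Real.pi * t * w = -(2 * Real.pi * w * t) := by ring
  simp only [this, smul_eq_mul, RCLike.mul_re, RCLike.re_eq_complex_re, RCLike.im_eq_complex_im,
    Complex.exp_ofReal_mul_I_re, Complex.ofReal_re, Complex.ofReal_im, Real.cos_neg]
  ring

lemma fourier_ofReal_im {f : ℝ → ℝ} (hf : Integrable f) (w : ℝ) :
    (𝓕 (fun t : ℝ => (f t : ℂ)) w).im = -∫ t, f t * Real.sin (2 * Real.pi * w * t) := by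
  rw [Real.fourier_real_eq_integral_exp_smul, ← integral_neg]
  refine (integral_im (integrable_exp_smul hf w)).symm.trans (integral_congr_ae ?_)
  refine Filter.Eventually.of_forall fun t => ?_
  have : -2 * Real.pi * t * w = -(2 * Real.pi * w * t) := by ring
  simp only [this, smul_eq_mul, RCLike.mul_im, RCLike.re_eq_complex_re, RCLike.im_eq_complex_im,
    Complex.exp_ofReal_mul_I_im, Complex.ofReal_re, Complex.ofReal_im, Real.sin_neg]
  ring

lemma fourier_ofReal_re_neg {f : ℝ → ℝ} (hf : Integrable f) (w : ℝ) :
    (𝓕 (fun t : ℝ => (f t : ℂ)) (-w)).re = (𝓕 (fun t : ℝ => (f t : ℂ)) w).re := by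
  simp [fourier_ofReal_re hf]

lemma fourier_ofReal_im_neg {f : ℝ → ℝ} (hf : Integrable f) (w : ℝ) :
    (𝓕 (fun t : ℝ => (f t : ℂ)) (-w)).im = -(𝓕 (fun t : ℝ => (f t : ℂ)) w).im := by
  simp [fourier_ofReal_im hf, integral_neg]

/-- An integrable function with vanishing Fourier transform vanishes almost everywhere. -/
lemma ae_eq_zero_of_fourier_eq_zero {f : ℝ → ℂ} (hf : Integrable f) (h : ∀ w, 𝓕 f w = 0) :
    ∀ᵐ x, f x = 0 := by
  refine ae_eq_zero_of_integral_contDiff_smul_eq_zero hf.locallyIntegrable fun g hg hgc => ?_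
  have hGc : HasCompactSupport fun x => (g x : ℂ) := hgc.comp_left (g := fun y : ℝ => (y : ℂ)) rfl
  set G : SchwartzMap ℝ ℂ := hGc.toSchwartzMap (Complex.ofRealCLM.contDiff.comp hg) with hG
  have hGi : 𝓕 (⇑(𝓕⁻ G : SchwartzMap ℝ ℂ)) = fun x => (g x : ℂ) := by
    rw [← SchwartzMap.fourier_coe, FourierTransform.fourier_fourierInv_eq]; rfl
  -- Multiplication formula `∫ f̂ φ = ∫ f φ̂` with `φ = 𝓕⁻ G`, so that `φ̂` is the given test
  -- function.
  have key := VectorFourier.integral_fourierIntegral_smul_eq_flip (μ := volume) (ν := volume)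
    (L := innerₗ ℝ) Real.continuous_fourierChar continuous_inner hf
    (𝓕⁻ G : SchwartzMap ℝ ℂ).integrable
  rw [flip_innerₗ] at key
  have h1 : ∀ ξ, VectorFourier.fourierIntegral Real.fourierChar volume (innerₗ ℝ) f ξ = 0 := h
  have h2 : VectorFourier.fourierIntegral Real.fourierChar volume (innerₗ ℝ) (⇑(𝓕⁻ G : SchwartzMap ℝ ℂ)) =
    fun x => (g x : ℂ) := hGi
  simp only [h1, h2, smul_eq_mul, zero_mul, integral_zero] at key
  rw [key]
  exact integral_congr_ae (Filter.Eventually.of_forall fun x => by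
    simp [mul_comm])

/-! ### Feature map, reproducing kernel Hilbert space and universality for a spectral density -/

/-- The requirements on a spectral density. -/
structure IsSpectralDensity (Q : ℝ → ℝ) : Prop where
  integrable : Integrable Q
  even : ∀ ω, Q (-ω) = Q ω
  nonneg : ∀ ω, 0 ≤ Q ω
  pos : ∀ ω, ω ≠ 0 → 0 < Q ω

/-- The Hartley kernel `cos + sin`. -/
noncomputable def cas (t ω : ℝ) : ℝ :=
  Real.cos (2 * Real.pi * t * ω) + Real.sin (2 * Real.pi * t * ω)

lemma continuous_cas (t : ℝ) : Continuous (cas t) := by unfold cas; fun_prop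

/-- The term in `s + t` is odd in `ω` and disappears against an even density. Only the difference
kernel remains, and the feature space can be real. -/
lemma cas_mul_cas (s t ω : ℝ) : cas s ω * cas t ω =
    Real.cos (2 * Real.pi * (s - t) * ω) + Real.sin (2 * Real.pi * (s + t) * ω) := by
  have h1 : 2 * Real.pi * (s - t) * ω = 2 * Real.pi * s * ω - 2 * Real.pi * t * ω := by ring
  have h2 : 2 * Real.pi * (s + t) * ω = 2 * Real.pi * s * ω + 2 * Real.pi * t * ω := by ring
  rw [h1, h2, Real.cos_sub, Real.sin_add, cas, cas]
  ring

lemma abs_cas_le (t ω : ℝ) : |cas t ω| ≤ 2 := by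
  have h1 := Real.abs_cos_le_one (2 * Real.pi * t * ω)
  have h2 := Real.abs_sin_le_one (2 * Real.pi * t * ω)
  exact (abs_add_le _ _).trans (by linarith)

namespace IsSpectralDensity

variable {Q : ℝ → ℝ}

lemma aestronglyMeasurable_sqrt (hQ : IsSpectralDensity Q) : AEStronglyMeasurable fun ω => √(Q ω) :=
  Real.continuous_sqrt.comp_aestronglyMeasurable hQ.integrable.aestronglyMeasurable

lemma memLp_feature (hQ : IsSpectralDensity Q) (t : ℝ) : MemLp (fun ω => √(Q ω) * cas t ω) 2 := by
  have hm : AEStronglyMeasurable fun ω => √(Q ω) * cas t ω :=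
    hQ.aestronglyMeasurable_sqrt.mul (continuous_cas t).aestronglyMeasurable
  rw [memLp_two_iff_integrable_sq hm]
  have : (fun ω => (√(Q ω) * cas t ω) ^ 2) = fun ω => Q ω * cas t ω ^ 2 := by
    ext ω; rw [mul_pow, Real.sq_sqrt (hQ.nonneg ω)]
  rw [this]
  refine hQ.integrable.mul_bdd (c := 4) ((continuous_cas t).pow 2).aestronglyMeasurable
    (Filter.Eventually.of_forall fun ω => ?_)
  rw [norm_pow, Real.norm_eq_abs]
  nlinarith [abs_cas_le t ω, abs_nonneg (cas t ω)]

/-- The feature map of the kernel with spectral density `Q`, in the real space `L²(ℝ)`. -/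
noncomputable def feature (hQ : IsSpectralDensity Q) (t : ℝ) : Lp ℝ 2 (volume : Measure ℝ) :=
  (hQ.memLp_feature t).toLp

lemma spectralKernel_eq (hQ : IsSpectralDensity Q) (s t : ℝ) :
    spectralKernel Q s t = ∫ ω, Q ω * Real.cos (2 * Real.pi * (s - t) * ω) :=
  fourier_ofReal_re hQ.integrable _

lemma spectralKernelC_im (hQ : IsSpectralDensity Q) (s t : ℝ) : (spectralKernelC Q s t).im = 0 := by
  rw [spectralKernelC, fourier_ofReal_im hQ.integrable, integral_eq_zero_of_odd, neg_zero]
  intro ω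
  simp [hQ.even]

lemma inner_feature_left (hQ : IsSpectralDensity Q) (u : Lp ℝ 2 (volume : Measure ℝ)) (t : ℝ) :
    inner ℝ u (hQ.feature t) = ∫ ω, u ω * (√(Q ω) * cas t ω) := by
  rw [L2.inner_def]
  refine integral_congr_ae ?_
  filter_upwards [(hQ.memLp_feature t).coeFn_toLp] with ω h
  rw [feature, h, real_inner_comm]
  rfl

lemma inner_feature (hQ : IsSpectralDensity Q) (s t : ℝ) :
    inner ℝ (hQ.feature s) (hQ.feature t) = spectralKernel Q s t := by
  rw [inner_feature_left, hQ.spectralKernel_eq]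
  have h0 : ∫ ω, Q ω * Real.sin (2 * Real.pi * (s + t) * ω) = 0 :=
    integral_eq_zero_of_odd fun ω => by simp [hQ.even]
  calc _ = ∫ ω, (Q ω * Real.cos (2 * Real.pi * (s - t) * ω)
      + Q ω * Real.sin (2 * Real.pi * (s + t) * ω)) := by
        refine integral_congr_ae ?_
        filter_upwards [(hQ.memLp_feature s).coeFn_toLp] with ω h
        rw [feature, h, ← mul_add, ← cas_mul_cas]
        linear_combination cas s ω * cas t ω * Real.mul_self_sqrt (hQ.nonneg ω)
    _ = _ := by
        rw [integral_add (integrable_mul_cos hQ.integrable _) (integrable_mul_sin hQ.integrable _),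
          h0, add_zero]

lemma ae_pos (hQ : IsSpectralDensity Q) : ∀ᵐ ω, 0 < Q ω := by
  filter_upwards [Measure.ae_ne volume (0 : ℝ)] with ω h using hQ.pos ω h

/-- The feature vectors span a dense subspace. -/
lemma dense_span_feature (hQ : IsSpectralDensity Q) :
    (Submodule.span ℝ (Set.range hQ.feature)).topologicalClosure = ⊤ := by
  rw [Submodule.topologicalClosure_eq_top_iff, Submodule.eq_bot_iff]
  intro w hw
  have hsq : MemLp (fun ω => √(Q ω)) 2 := by
    rw [memLp_two_iff_integrable_sq hQ.aestronglyMeasurable_sqrt]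
    simpa only [Real.sq_sqrt (hQ.nonneg _)] using hQ.integrable
  have hi : Integrable fun ω => w ω * √(Q ω) := (Lp.memLp w).integrable_mul hsq
  have hcs : ∀ t, (∫ ω, w ω * √(Q ω) * Real.cos (2 * Real.pi * t * ω)) +
      ∫ ω, w ω * √(Q ω) * Real.sin (2 * Real.pi * t * ω) = 0 := by
    intro t
    have h := (Submodule.mem_orthogonal' _ _).1 hw _ (Submodule.subset_span ⟨t, rfl⟩)
    rw [hQ.inner_feature_left] at h
    rw [← integral_add (integrable_mul_cos hi _) (integrable_mul_sin hi _), ← h]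
    refine integral_congr_ae (Filter.Eventually.of_forall fun ω => ?_)
    simp only [cas]; ring
  have hz := ae_eq_zero_of_fourier_eq_zero hi.ofReal fun t => by
    -- Orthogonality at `t` and at `-t` separates the cosine integral from the sine integral.
    have h1 := hcs t
    have h2 := hcs (-t)
    simp only [mul_neg, neg_mul, Real.cos_neg, Real.sin_neg, integral_neg] at h2
    apply Complex.ext
    · refine (fourier_ofReal_re hi t).trans ?_
      simp only [Complex.zero_re]; linarith
    · refine (fourier_ofReal_im hi t).trans ?_
      simp only [Complex.zero_im]; linarith
  rw [Lp.eq_zero_iff_ae_eq_zero]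
  filter_upwards [hz, hQ.ae_pos] with ω h1 h2
  have h1' : w ω * √(Q ω) = 0 := by simpa using h1
  simpa [(Real.sqrt_pos.2 h2).ne'] using h1'

lemma isTranslationInvariant (Q : ℝ → ℝ) : IsTranslationInvariant (spectralKernel Q) := by
  intro s t h
  simp [spectralKernel, spectralKernelC]

lemma spectralKernel_self (hQ : IsSpectralDensity Q) (t : ℝ) : spectralKernel Q t t = ∫ ω, Q ω := by
  simp [hQ.spectralKernel_eq]

lemma norm_feature_sq (hQ : IsSpectralDensity Q) (t : ℝ) : ‖hQ.feature t‖ ^ 2 = ∫ ω, Q ω := by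
  rw [← real_inner_self_eq_norm_sq, hQ.inner_feature, hQ.spectralKernel_self]

lemma spectralKernel_comm (hQ : IsSpectralDensity Q) (s t : ℝ) :
    spectralKernel Q s t = spectralKernel Q t s := by
  rw [← hQ.inner_feature, ← hQ.inner_feature, real_inner_comm]

lemma posSemidef (hQ : IsSpectralDensity Q) : (Matrix.of (spectralKernel Q)).PosSemidef := by
  refine ⟨?_, fun x => ?_⟩
  · ext s t
    simp [← hQ.inner_feature, real_inner_comm]
  · have : x.sum (fun i xi => x.sum fun j xj => star xi * Matrix.of (spectralKernel Q) i j * xj)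
        = inner ℝ (x.sum fun i a => a • hQ.feature i) (x.sum fun i a => a • hQ.feature i) := by
      simp only [Finsupp.sum, sum_inner, inner_sum, inner_smul_left, inner_smul_right,
        hQ.inner_feature, Matrix.of_apply, star_trivial, conj_trivial]
      simp only [Finset.mul_sum]
      exact Finset.sum_congr rfl fun i _ => Finset.sum_congr rfl fun j _ => by
        rw [hQ.spectralKernel_comm j i]; ring
    rw [this]
    exact real_inner_self_nonneg

/-- A continuous integrable function with finite spectral norm is represented, through the feature
map, by a vector of `L²` whose norm is the spectral norm. -/
lemma exists_representer (hQ : IsSpectralDensity Q) {f : ℝ → ℝ} (hfc : Continuous f)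
    (hfi : Integrable f) (hfin : spectralNormSq Q f ≠ ∞) :
    ∃ u : Lp ℝ 2 (volume : Measure ℝ), (∀ t, inner ℝ u (hQ.feature t) = f t) ∧
      ENNReal.ofReal (‖u‖ ^ 2) = spectralNormSq Q f := by
  set F : ℝ → ℂ := 𝓕 (fun t : ℝ => (f t : ℂ)) with hF
  have hFc : Continuous F :=
    VectorFourier.fourierIntegral_continuous Real.continuous_fourierChar continuous_inner
      hfi.ofReal
  have hre : ∀ ω, (F (-ω)).re = (F ω).re := fourier_ofReal_re_neg hfi
  have him : ∀ ω, (F (-ω)).im = -(F ω).im := fourier_ofReal_im_neg hfi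
  have hQm := hQ.integrable.aestronglyMeasurable
  have hnn : ∀ ω, 0 ≤ ‖F ω‖ ^ 2 / Q ω := fun ω => div_nonneg (sq_nonneg _) (hQ.nonneg ω)
  have hint : Integrable fun ω => ‖F ω‖ ^ 2 / Q ω := by
    refine (lintegral_ofReal_ne_top_iff_integrable
      ((hFc.norm.pow 2).aestronglyMeasurable.div₀ hQm) (Filter.Eventually.of_forall hnn)).1 hfin
  have hnorm : ∀ ω, ‖F ω‖ ^ 2 = (F ω).re ^ 2 + (F ω).im ^ 2 := fun ω => by
    rw [Complex.sq_norm, Complex.normSq_apply]; ring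
  -- By AM-GM, `|F| ≤ |F|²/Q + Q` almost everywhere; this integrability is what Fourier inversion
  -- needs.
  have hFi : Integrable F := by
    refine (hint.add hQ.integrable).mono' hFc.aestronglyMeasurable ?_
    filter_upwards [hQ.ae_pos] with ω hω
    simp only [Pi.add_apply]
    have h1 : ‖F ω‖ ^ 2 / Q ω * Q ω = ‖F ω‖ ^ 2 := by field_simp
    have h2 := hnn ω
    by_contra! h
    have h3 := norm_nonneg (F ω)
    nlinarith [mul_nonneg h2 hω.le, sq_nonneg (‖F ω‖ ^ 2 / Q ω), sq_nonneg (Q ω)]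
  -- The Hartley transform of `f`, a real substitute for `F`. Its square differs from `|F|²` by the
  -- odd term `-2 Re F Im F`.
  set h : ℝ → ℝ := fun ω => (F ω).re - (F ω).im with hh
  have hhc : Continuous h := by fun_prop
  set v : ℝ → ℝ := fun ω => h ω / √(Q ω) with hv
  have hvm : AEStronglyMeasurable v := hhc.aestronglyMeasurable.div₀ hQ.aestronglyMeasurable_sqrt
  have hv2 : ∀ ω, v ω ^ 2 = ‖F ω‖ ^ 2 / Q ω + (-2 * ((F ω).re * (F ω).im)) / Q ω := fun ω => by
    rw [hv, ← add_div, hnorm, div_pow, Real.sq_sqrt (hQ.nonneg ω)]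
    congr 1; simp only [hh]; ring
  have hcross : Integrable fun ω => (-2 * ((F ω).re * (F ω).im)) / Q ω := by
    refine hint.mono' ?_ (Filter.Eventually.of_forall fun ω => ?_)
    · exact (Continuous.aestronglyMeasurable (by fun_prop)).div₀ hQm
    · rw [norm_div, Real.norm_of_nonneg (hQ.nonneg ω)]
      refine div_le_div_of_nonneg_right ?_ (hQ.nonneg ω)
      rw [hnorm, Real.norm_eq_abs, abs_le]
      constructor <;> nlinarith [sq_nonneg ((F ω).re + (F ω).im), sq_nonneg ((F ω).re - (F ω).im)]
  have hvL : MemLp v 2 := by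
    rw [memLp_two_iff_integrable_sq hvm]
    simp only [hv2]
    exact hint.add hcross
  refine ⟨hvL.toLp, fun t => ?_, ?_⟩
  · rw [hQ.inner_feature_left]
    have hinv : 𝓕⁻ F t = f t := by
      exact congrFun ((Complex.continuous_ofReal.comp hfc).fourierInv_fourier_eq hfi.ofReal hFi) t
    -- The first bracket is the real part of the inversion integrand; the second is odd and
    -- integrates to zero.
    have hcas : ∫ ω, (hvL.toLp : ℝ → ℝ) ω * (√(Q ω) * cas t ω) = ∫ ω,
        (((F ω).re * Real.cos (2 * Real.pi * t * ω) - (F ω).im * Real.sin (2 * Real.pi * t * ω)) +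
        ((F ω).re * Real.sin (2 * Real.pi * t * ω) - (F ω).im * Real.cos (2 * Real.pi * t * ω))) := by
      refine integral_congr_ae ?_
      filter_upwards [hvL.coeFn_toLp, hQ.ae_pos] with ω h1 h2
      have h3 := (Real.sqrt_pos.2 h2).ne'
      rw [h1, hv, cas]
      simp only [hh]
      field_simp
      ring
    have hexp : ∀ ω, Complex.exp (↑(2 * Real.pi * inner ℝ ω t) * Complex.I) • F ω =
        Complex.exp (↑(2 * Real.pi * t * ω) * Complex.I) * F ω := fun ω => by
      rw [smul_eq_mul, mul_assoc (2 * Real.pi)]; rfl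
    have hEi : Integrable fun ω => Complex.exp (↑(2 * Real.pi * t * ω) * Complex.I) * F ω := by
      refine hFi.bdd_mul (c := 1) (by fun_prop) (Filter.Eventually.of_forall fun ω => ?_)
      rw [Complex.norm_exp_ofReal_mul_I]
    rw [hcas, integral_add, add_eq_left.2 (integral_eq_zero_of_odd (f := fun ω =>
      (F ω).re * Real.sin (2 * Real.pi * t * ω) - (F ω).im * Real.cos (2 * Real.pi * t * ω)) ?_)]
    · rw [Real.fourierInv_eq'] at hinv
      simp only [hexp] at hinv
      have h2 := congrArg Complex.re hinv
      rw [Complex.ofReal_re] at h2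
      rw [← h2]
      refine Eq.trans ?_ (integral_re hEi)
      refine integral_congr_ae (Filter.Eventually.of_forall fun ω => ?_)
      simp only [RCLike.mul_re, RCLike.re_eq_complex_re, RCLike.im_eq_complex_im,
        Complex.exp_ofReal_mul_I_re, Complex.exp_ofReal_mul_I_im]
      ring
    · intro ω
      simp only [hre, him, mul_neg, Real.sin_neg, Real.cos_neg]
      ring
    · exact (integrable_mul_cos hFi.re _).sub (integrable_mul_sin hFi.im _)
    · exact (integrable_mul_sin hFi.re _).sub (integrable_mul_cos hFi.im _)
  · have hodd : ∫ ω, (-2 * ((F ω).re * (F ω).im)) / Q ω = 0 :=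
      integral_eq_zero_of_odd fun ω => by simp only [hre, him, hQ.even]; ring
    have : ‖hvL.toLp‖ ^ 2 = ∫ ω, ‖F ω‖ ^ 2 / Q ω := by
      rw [← real_inner_self_eq_norm_sq, L2.inner_def]
      rw [← add_zero (∫ ω, ‖F ω‖ ^ 2 / Q ω), ← hodd, ← integral_add hint hcross]
      refine integral_congr_ae ?_
      filter_upwards [hvL.coeFn_toLp] with ω h1
      rw [h1, ← hv2, sq]; rfl
    rw [this, ofReal_integral_eq_lintegral_ofReal hint (Filter.Eventually.of_forall hnn)]
    rfl

/-- A function represented through the feature map lies in every reproducing kernel Hilbert space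
with kernel `spectralKernel Q`, with the same norm. -/
lemma exists_rkhs_of_representer (hQ : IsSpectralDensity Q) {H : Type*} [NormedAddCommGroup H]
    [InnerProductSpace ℝ H] [CompleteSpace H] [RKHS ℝ H ℝ ℝ]
    (hH : HasReproducingKernel H (spectralKernel Q)) (u : Lp ℝ 2 (volume : Measure ℝ)) :
    ∃ g : H, (∀ t, g t = inner ℝ u (hQ.feature t)) ∧ ‖g‖ = ‖u‖ := by
  have hK : ∀ s t, inner ℝ (RKHS.kerFun H s (1 : ℝ)) (RKHS.kerFun H t (1 : ℝ)) =
      inner ℝ (hQ.feature s) (hQ.feature t) := fun s t => by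
    rw [RKHS.kerFun_inner, RKHS.kerFun_apply, hH, hQ.inner_feature]
    simp
  set A : (ℝ →₀ ℝ) →ₗ[ℝ] Lp ℝ 2 (volume : Measure ℝ) := Finsupp.linearCombination ℝ hQ.feature
  set B : (ℝ →₀ ℝ) →ₗ[ℝ] H := Finsupp.linearCombination ℝ fun s => RKHS.kerFun H s (1 : ℝ)
  -- Equal Gram matrices make `A a ↦ B a` isometric. Density of the range of `A` and completeness of
  -- `H` then extend it to `u` along a sequence.
  have hin : ∀ a b, inner ℝ (B a) (B b) = inner ℝ (A a) (A b) := fun a b => by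
    simp only [A, B, Finsupp.linearCombination_apply, Finsupp.sum, sum_inner, inner_sum,
      inner_smul_left, inner_smul_right, hK]
  have hnorm : ∀ a, ‖B a‖ = ‖A a‖ := fun a => by
    rw [← sq_eq_sq₀ (norm_nonneg _) (norm_nonneg _), ← real_inner_self_eq_norm_sq,
      ← real_inner_self_eq_norm_sq, hin]
  have hu : u ∈ closure (Set.range A) := by
    have h1 : u ∈ (Submodule.span ℝ (Set.range hQ.feature)).topologicalClosure := by
      rw [hQ.dense_span_feature]; trivial
    rw [← Finsupp.range_linearCombination] at h1
    exact h1
  obtain ⟨x, hx, hxu⟩ := mem_closure_iff_seq_limit.1 hu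
  choose a ha using hx
  have hAu : Filter.Tendsto (fun n => A (a n)) Filter.atTop (nhds u) := by simpa only [ha] using hxu
  have hcau : CauchySeq fun n => B (a n) := by
    have := hAu.cauchySeq
    rw [Metric.cauchySeq_iff] at this ⊢
    simpa only [dist_eq_norm, ← map_sub, hnorm] using this
  obtain ⟨g, hg⟩ := cauchySeq_tendsto_of_complete hcau
  refine ⟨g, fun t => ?_, ?_⟩
  · refine tendsto_nhds_unique (((RKHS.continuous_eval t).tendsto g).comp hg) ?_
    have h1 := (hAu.inner (tendsto_const_nhds (x := hQ.feature t)) (𝕜 := ℝ))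
    refine h1.congr fun n => ?_
    have h2 : RKHS.kerFun H t (1 : ℝ) = B (Finsupp.single t 1) := by simp [B]
    have h3 : hQ.feature t = A (Finsupp.single t 1) := by simp [A]
    have h4 := RKHS.inner_kerFun t (1 : ℝ) (B (a n))
    rw [h2, hin, ← h3] at h4
    rw [h4]
    simp
  · refine tendsto_nhds_unique hg.norm ?_
    simpa only [hnorm] using hAu.norm

lemma exists_rkhs_norm_eq (hQ : IsSpectralDensity Q) {f : ℝ → ℝ} (hfc : Continuous f)
    (hfi : Integrable f) (hfin : spectralNormSq Q f ≠ ∞) {H : Type*} [NormedAddCommGroup H]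
    [InnerProductSpace ℝ H] [CompleteSpace H] [RKHS ℝ H ℝ ℝ]
    (hH : HasReproducingKernel H (spectralKernel Q)) :
    ∃ g : H, (⇑g : ℝ → ℝ) = f ∧ ENNReal.ofReal (‖g‖ ^ 2) = spectralNormSq Q f := by
  obtain ⟨u, hu, hn⟩ := hQ.exists_representer hfc hfi hfin
  obtain ⟨g, hg, hgn⟩ := hQ.exists_rkhs_of_representer hH u
  exact ⟨g, funext fun t => (hg t).trans (hu t), by rw [hgn, hn]⟩

/-- If smooth compactly supported functions have finite spectral norm then the kernel is
universal. -/
lemma isUniversalKernel (hQ : IsSpectralDensity Q)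
    (hfin : ∀ f : ℝ → ℝ, ContDiff ℝ 2 f → HasCompactSupport f → spectralNormSq Q f ≠ ∞) :
    IsUniversalKernel (spectralKernel Q) := by
  intro K hK φ hφ ε hε
  -- approximation by a polynomial
  obtain ⟨p, hp⟩ : ∃ p : Polynomial ℝ, ∀ t ∈ K, |p.eval t - φ t| < ε / 2 := by
    have : CompactSpace K := isCompact_iff_compactSpace.1 hK
    have h1 : (⟨K.domRestrict φ, hφ.domRestrict⟩ : C(K, ℝ)) ∈
        (polynomialFunctions K).topologicalClosure := by
      rw [polynomialFunctions.topologicalClosure]; trivial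
    obtain ⟨q, hq, hd⟩ := Metric.mem_closure_iff.1 h1 (ε / 2) (by positivity)
    obtain ⟨p, -, rfl⟩ := hq
    refine ⟨p, fun t ht => ?_⟩
    have h2 := (ContinuousMap.dist_apply_le_dist (⟨t, ht⟩ : K)).trans_lt hd
    rw [dist_comm, Real.dist_eq] at h2
    exact h2
  -- a smooth compactly supported function that agrees with it on `K`
  obtain ⟨f, hf, hfc, hfp⟩ : ∃ f : ℝ → ℝ, ContDiff ℝ 2 f ∧ HasCompactSupport f ∧
      ∀ t ∈ K, f t = p.eval t := by
    obtain ⟨r, hr, hKr⟩ := hK.isBounded.subset_closedBall_lt 0 (0 : ℝ)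
    let b : ContDiffBump (0 : ℝ) := ⟨r, r + 1, hr, by linarith⟩
    refine ⟨fun t => b t * p.eval t, b.contDiff.mul (by simpa using p.contDiff_aeval (𝕜 := ℝ) 2), b.hasCompactSupport.mul_right,
      fun t ht => ?_⟩
    beta_reduce
    rw [b.one_of_mem_closedBall (hKr ht), one_mul]
  obtain ⟨u, hu, -⟩ := hQ.exists_representer hf.continuous
    (hf.continuous.integrable_of_hasCompactSupport hfc) (hfin f hf hfc)
  -- projection onto the span of the features with centre in `K`
  set W : Submodule ℝ (Lp ℝ 2 (volume : Measure ℝ)) :=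
    (Submodule.span ℝ (hQ.feature '' K)).topologicalClosure with hW
  have : CompleteSpace W := (Submodule.isClosed_topologicalClosure _).completeSpace_coe
  have hmem := W.starProjection_apply_mem u
  set w := W.starProjection u with hw
  -- Projecting loses nothing on `K`, since the discarded part is orthogonal to every feature
  -- centred there.
  have hwf : ∀ t ∈ K, inner ℝ w (hQ.feature t) = f t := fun t ht => by
    have h1 := W.starProjection_inner_eq_zero u (hQ.feature t)
      (Submodule.le_topologicalClosure _ (Submodule.subset_span ⟨t, ht, rfl⟩))
    rw [inner_sub_left, hu] at h1
    linarith
  -- All features have this same norm, so an `L²` error of the representer is a uniform error of the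
  -- function.
  set M := √(∫ ω, Q ω) with hM
  have hMn : ∀ t, ‖hQ.feature t‖ = M := fun t => by
    rw [hM, ← hQ.norm_feature_sq t, Real.sqrt_sq (norm_nonneg _)]
  have hM0 : 0 ≤ M := Real.sqrt_nonneg _
  obtain ⟨q, hq, hd⟩ := Metric.mem_closure_iff.1 hmem (ε / 2 / (M + 1)) (by positivity)
  obtain ⟨a, haK, rfl⟩ := (Finsupp.mem_span_image_iff_linearCombination ℝ).1 hq
  refine ⟨a, haK, fun t ht => ?_⟩
  have h1 : a.sum (fun s b => b * spectralKernel Q s t) =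
      inner ℝ (Finsupp.linearCombination ℝ hQ.feature a) (hQ.feature t) := by
    simp only [Finsupp.linearCombination_apply, Finsupp.sum, sum_inner, inner_smul_left,
      hQ.inner_feature, conj_trivial]
  have h2 : |f t - a.sum (fun s b => b * spectralKernel Q s t)| < ε / 2 := by
    rw [h1, ← hwf t ht, ← inner_sub_left]
    refine (abs_real_inner_le_norm _ _).trans_lt ?_
    rw [hMn, ← dist_eq_norm]
    calc _ ≤ ε / 2 / (M + 1) * M := mul_le_mul_of_nonneg_right hd.le hM0
      _ < ε / 2 / (M + 1) * (M + 1) := by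
        have : 0 < ε / 2 / (M + 1) := by positivity
        nlinarith
      _ = ε / 2 := by field_simp
  have h3 := hp t ht
  rw [← hfp t ht] at h3
  rw [abs_lt] at h2 h3 ⊢
  constructor <;> linarith

end IsSpectralDensity

/-! ### Sine transforms of odd weights that decrease on the half line -/

/-- The sine transform of `V`. -/
noncomputable def sineTransform (V : ℝ → ℝ) (z : ℝ) : ℝ :=
  ∫ ω, V ω * Real.sin (2 * Real.pi * z * ω)

lemma sineTransform_neg (V : ℝ → ℝ) (z : ℝ) : sineTransform V (-z) = -sineTransform V z := by
  simp [sineTransform, integral_neg]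

lemma continuous_sineTransform {V : ℝ → ℝ} (hV : Integrable V) : Continuous (sineTransform V) := by
  have h1 : Continuous (𝓕 (fun t : ℝ => (V t : ℂ))) :=
    VectorFourier.fourierIntegral_continuous Real.continuous_fourierChar continuous_inner hV.ofReal
  have h2 : sineTransform V = fun z => -(𝓕 (fun t : ℝ => (V t : ℂ)) z).im := by
    ext z; rw [fourier_ofReal_im hV, neg_neg, sineTransform]
  rw [h2]
  fun_prop

lemma sineTransform_eq_two_mul {V : ℝ → ℝ} (hodd : ∀ ω, V (-ω) = -V ω) (z : ℝ) :
    sineTransform V z = 2 * ∫ ω in Set.Ioi 0, V ω * Real.sin (2 * Real.pi * z * ω) := by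
  rw [← integral_comp_abs (f := fun ω => V ω * Real.sin (2 * Real.pi * z * ω)), sineTransform]
  congr 1; ext ω
  rcases abs_choice ω with h | h <;> simp [h, hodd]

/-- The integral of a nonincreasing function against a sine over its full periods is
nonnegative. -/
lemma integral_mul_sin_nonneg {V : ℝ → ℝ} (hV : Integrable V) (hanti : AntitoneOn V (Set.Ioi 0))
    {z : ℝ} (hz : 0 < z) :
    0 ≤ ∫ ω in Set.Ioi 0, V ω * Real.sin (2 * Real.pi * z * ω) := by
  set F := fun ω => V ω * Real.sin (2 * Real.pi * z * ω) with hF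
  have hFi : Integrable F := integrable_mul_sin hV _
  -- Half a period of the sine. Shifting by `h` flips its sign, so pairing the two halves of a
  -- period leaves `(V ω - V (ω + h)) sin ≥ 0`.
  set h := 1 / (2 * z) with hh
  have hh0 : 0 < h := by positivity
  have hzh : 2 * Real.pi * z * h = Real.pi := by rw [hh]; field_simp
  have hii : ∀ a b, IntervalIntegrable F volume a b := fun a b => hFi.intervalIntegrable
  have hperiod : ∀ k : ℕ, 0 ≤ ∫ ω in (2 * h * k)..(2 * h * (k + 1)), F ω := by
    intro k
    have hk : 0 ≤ 2 * h * k := by positivity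
    rw [← intervalIntegral.integral_add_adjacent_intervals (hii _ (2 * h * k + h)) (hii _ _)]
    have e1 : 2 * h * (k + 1) = 2 * h * k + h + h := by ring
    rw [e1, ← intervalIntegral.integral_comp_add_right F h,
      ← intervalIntegral.integral_add (hii _ _) (hFi.comp_add_right h).intervalIntegrable]
    refine intervalIntegral.integral_nonneg_of_ae_restrict (by linarith) ?_
    -- The open interval excludes `ω = 0`, where monotonicity is not available.
    rw [← restrict_Ioo_eq_restrict_Icc]
    filter_upwards [ae_restrict_mem measurableSet_Ioo] with ω hω
    have hω0 : 0 < ω := hk.trans_lt hω.1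
    have e2 : 2 * Real.pi * z * (ω + h) = 2 * Real.pi * z * ω + Real.pi := by
      rw [mul_add, hzh]
    have e3 : F ω + F (ω + h) = (V ω - V (ω + h)) * Real.sin (2 * Real.pi * z * ω) := by
      simp only [hF, e2, Real.sin_add_pi]; ring
    rw [Pi.zero_apply, e3]
    refine mul_nonneg (sub_nonneg.2 (hanti hω0 (by simp only [Set.mem_Ioi]; linarith) (by linarith))) ?_
    have e4 : 2 * Real.pi * z * ω =
        2 * Real.pi * z * (ω - 2 * h * k) + k * (2 * Real.pi) := by
      linear_combination 2 * (k : ℝ) * hzh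
    rw [e4, Real.sin_add_nat_mul_two_pi]
    have hc : 0 < 2 * Real.pi * z := by positivity
    refine Real.sin_nonneg_of_nonneg_of_le_pi (mul_nonneg hc.le (by linarith [hω.1])) ?_
    calc _ ≤ 2 * Real.pi * z * h := mul_le_mul_of_nonneg_left (by linarith [hω.2]) hc.le
      _ = _ := hzh
  have hpart : ∀ n : ℕ, 0 ≤ ∫ ω in (0 : ℝ)..(2 * h * n), F ω := by
    intro n
    induction n with
    | zero => simp
    | succ k ih =>
      rw [← intervalIntegral.integral_add_adjacent_intervals (hii _ (2 * h * k)) (hii _ _)]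
      push_cast
      exact add_nonneg ih (hperiod k)
  refine ge_of_tendsto' (intervalIntegral_tendsto_integral_Ioi 0 hFi.integrableOn
    (Filter.Tendsto.const_mul_atTop (by positivity) tendsto_natCast_atTop_atTop)) hpart

lemma sineTransform_nonneg {V : ℝ → ℝ} (hV : Integrable V) (hodd : ∀ ω, V (-ω) = -V ω)
    (hanti : AntitoneOn V (Set.Ioi 0)) {z : ℝ} (hz : 0 ≤ z) : 0 ≤ sineTransform V z := by
  rcases hz.eq_or_lt with rfl | hz
  · simp [sineTransform]
  · rw [sineTransform_eq_two_mul hodd]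
    have := integral_mul_sin_nonneg hV hanti hz
    positivity

/-- The integral of the modulus of the sine transform of an odd function, nonincreasing on the
positive half line. -/
lemma integral_abs_sineTransform {V : ℝ → ℝ} (hV : Integrable V) (hodd : ∀ ω, V (-ω) = -V ω)
    (hanti : AntitoneOn V (Set.Ioi 0)) {a : ℝ} (ha : 0 ≤ a) :
    ∫ z in (-a)..a, |sineTransform V z| =
      4 * ∫ ω in Set.Ioi 0, V ω * ((1 - Real.cos (2 * Real.pi * a * ω)) / (2 * Real.pi * ω)) := by
  have hc := (continuous_sineTransform hV).abs
  have h0 : ∫ z in (-a)..0, |sineTransform V z| = ∫ z in (0 : ℝ)..a, |sineTransform V z| := by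
    have := intervalIntegral.integral_comp_neg (a := 0) (b := a) fun z => |sineTransform V z|
    simp only [sineTransform_neg, abs_neg, neg_zero] at this
    exact this.symm
  -- Positivity removes the modulus, which is why the final formula is an equality.
  have h1 : ∫ z in (0 : ℝ)..a, |sineTransform V z| =
      ∫ z in (0 : ℝ)..a, 2 * ∫ ω in Set.Ioi 0, V ω * Real.sin (2 * Real.pi * z * ω) := by
    refine intervalIntegral.integral_congr fun z hz => ?_
    rw [Set.uIcc_of_le ha] at hz
    rw [abs_of_nonneg (sineTransform_nonneg hV hodd hanti hz.1), sineTransform_eq_two_mul hodd]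
  rw [← intervalIntegral.integral_add_adjacent_intervals (hc.intervalIntegrable _ 0)
    (hc.intervalIntegrable _ _), h0, h1, intervalIntegral.integral_const_mul,
    intervalIntegral.integral_of_le ha]
  have hswap : ∫ z in Set.Ioc 0 a, ∫ ω in Set.Ioi 0, V ω * Real.sin (2 * Real.pi * z * ω) =
      ∫ ω in Set.Ioi 0, ∫ z in Set.Ioc 0 a, V ω * Real.sin (2 * Real.pi * z * ω) := by
    refine integral_integral_swap ?_
    have hi := ((integrable_const (1 : ℝ)).mul_prod hV.integrableOn :
      Integrable _ ((volume.restrict (Set.Ioc 0 a)).prod (volume.restrict (Set.Ioi (0 : ℝ)))))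
    refine (hi.mul_bdd (c := 1) (g := fun p : ℝ × ℝ => Real.sin (2 * Real.pi * p.1 * p.2))
      (by fun_prop) (Filter.Eventually.of_forall fun p => Real.abs_sin_le_one _)).congr ?_
    exact Filter.Eventually.of_forall fun p => by simp [Function.uncurry]
  rw [hswap, ← two_mul, ← mul_assoc]
  norm_num
  refine setIntegral_congr_fun measurableSet_Ioi fun ω hω => ?_
  have hω0 : (0 : ℝ) < ω := hω
  rw [integral_const_mul, ← intervalIntegral.integral_of_le ha]
  congr 1
  have hd : ∀ z ∈ Set.uIcc 0 a, HasDerivAt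
      (fun z => -Real.cos (2 * Real.pi * z * ω) / (2 * Real.pi * ω))
      (Real.sin (2 * Real.pi * z * ω)) z := fun z _ => by
    have h2 : HasDerivAt (fun z => 2 * Real.pi * z * ω) (2 * Real.pi * ω) z := by
      simpa using ((hasDerivAt_id z).const_mul (2 * Real.pi)).mul_const ω
    refine (h2.cos.neg.div_const (2 * Real.pi * ω)).congr_deriv ?_
    have := Real.pi_pos.ne'
    field_simp
  rw [intervalIntegral.integral_eq_sub_of_hasDerivAt hd
    (Continuous.intervalIntegrable (by fun_prop) _ _)]
  simp
  ring

/-! ### The spectral norm as a bilinear form in `f'` and `f - f''` -/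

/-- Fubini's theorem for a spectral bilinear form with odd spectral weight `V`. -/
lemma integral_mul_cross_eq {V g p : ℝ → ℝ} (hV : Integrable V) (hg : Integrable g)
    (hp : Integrable p) {J : ℝ → ℝ}
    (hJ : ∀ ω, J ω = (∫ x, g x * Real.sin (2 * Real.pi * ω * x)) *
        (∫ y, p y * Real.cos (2 * Real.pi * ω * y)) -
      (∫ x, g x * Real.cos (2 * Real.pi * ω * x)) * ∫ y, p y * Real.sin (2 * Real.pi * ω * y)) :
    Integrable (fun ω => V ω * J ω) ∧
      ∫ ω, V ω * J ω = ∫ y, p y * ∫ x, g x * sineTransform V (x - y) := by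
  set Φ : ℝ → ℝ × ℝ → ℝ := fun ω q =>
    V ω * (p q.1 * g q.2 * Real.sin (2 * Real.pi * ω * (q.2 - q.1))) with hΦ
  have hpg : Integrable (fun q : ℝ × ℝ => p q.1 * g q.2) (volume.prod volume) := hp.mul_prod hg
  have hΦi : Integrable (Function.uncurry Φ) (volume.prod (volume.prod volume)) := by
    refine ((hV.mul_prod hpg).mul_bdd (c := 1)
      (g := fun r : ℝ × ℝ × ℝ => Real.sin (2 * Real.pi * r.1 * (r.2.2 - r.2.1)))
      (by fun_prop) (Filter.Eventually.of_forall fun r => Real.abs_sin_le_one _)).congr ?_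
    exact Filter.Eventually.of_forall fun r => by simp only [Function.uncurry, hΦ]; ring
  have hJΦ : ∀ ω, V ω * J ω = ∫ q, Φ ω q ∂(volume.prod volume) := by
    intro ω
    rw [hΦ, integral_const_mul, hJ]
    congr 1
    rw [mul_comm (∫ x, g x * Real.sin _), mul_comm (∫ x, g x * Real.cos _), ← integral_prod_mul,
      ← integral_prod_mul, ← integral_sub]
    · refine integral_congr_ae (Filter.Eventually.of_forall fun q => ?_)
      simp only [mul_sub, Real.sin_sub]
      ring
    · exact (integrable_mul_cos hp _).mul_prod (integrable_mul_sin hg _)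
    · exact (integrable_mul_sin hp _).mul_prod (integrable_mul_cos hg _)
  have hswap : ∀ q : ℝ × ℝ, ∫ ω, Φ ω q = p q.1 * (g q.2 * sineTransform V (q.2 - q.1)) := by
    intro q
    rw [sineTransform, ← mul_assoc, ← integral_const_mul]
    refine integral_congr_ae (Filter.Eventually.of_forall fun ω => ?_)
    have : 2 * Real.pi * (q.2 - q.1) * ω = 2 * Real.pi * ω * (q.2 - q.1) := by ring
    simp only [hΦ, this]
    ring
  constructor
  · simp only [hJΦ]
    exact hΦi.integral_prod_left
  · simp only [hJΦ]
    rw [integral_integral_swap hΦi, integral_prod (fun q => ∫ ω, Φ ω q) hΦi.integral_prod_right]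
    refine integral_congr_ae (Filter.Eventually.of_forall fun y => ?_)
    simp only
    rw [← integral_const_mul]
    exact integral_congr_ae (Filter.Eventually.of_forall fun x => hswap (y, x))

/-- A bilinear form with a difference kernel, on functions supported in `[0, a]`. -/
lemma abs_integral_mul_le {S g p : ℝ → ℝ} (hS : Continuous S) (hp : Integrable p) {a B : ℝ}
    (ha : 0 ≤ a) (hB : ∀ᵐ x, |g x| ≤ B) (hgs : ∀ x, x ∉ Set.Icc 0 a → g x = 0)
    (hps : ∀ x, x ∉ Set.Icc 0 a → p x = 0) :
    |∫ y, p y * ∫ x, g x * S (x - y)| ≤ (∫ y, |p y|) * (B * ∫ z in (-a)..a, |S z|) := by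
  have hB0 : 0 ≤ B := by
    obtain ⟨x, hx⟩ := hB.exists
    exact (abs_nonneg _).trans hx
  rw [← integral_mul_const, ← Real.norm_eq_abs]
  refine norm_integral_le_of_norm_le (hp.abs.mul_const _) (Filter.Eventually.of_forall fun y => ?_)
  by_cases hy : y ∈ Set.Icc 0 a
  swap
  · simp [hps y hy]
  rw [norm_mul, Real.norm_eq_abs (p y)]
  refine mul_le_mul_of_nonneg_left ?_ (abs_nonneg _)
  rw [← setIntegral_eq_integral_of_forall_compl_eq_zero (s := Set.Icc 0 a)
    fun x hx => by rw [hgs x hx, zero_mul]]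
  have hSa := hS.abs
  have h1 : ‖∫ x in Set.Icc 0 a, g x * S (x - y)‖ ≤ ∫ x in Set.Icc 0 a, B * |S (x - y)| := by
    refine norm_integral_le_of_norm_le
      (Continuous.integrableOn_Icc (by fun_prop)) (ae_restrict_of_ae ?_)
    filter_upwards [hB] with x hx
    rw [norm_mul]
    exact mul_le_mul_of_nonneg_right hx (abs_nonneg _)
  refine h1.trans ?_
  rw [integral_const_mul, integral_Icc_eq_integral_Ioc, ← intervalIntegral.integral_of_le ha,
    intervalIntegral.integral_comp_sub_right (fun z => |S z|)]
  refine mul_le_mul_of_nonneg_left ?_ hB0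
  -- For `x` and `y` in `[0, a]` the difference `x - y` stays in `[-a, a]`.
  exact intervalIntegral.integral_mono_interval (by linarith [hy.2]) (by linarith [hy.1, hy.2])
    (by linarith [hy.1]) (Filter.Eventually.of_forall fun z => abs_nonneg _)
    (hSa.intervalIntegrable _ _)

/-- Differentiability everywhere and an integrable derivative suffice. As no continuity of the
derivative is needed, this applies to `f'` as well as to `f`. -/
lemma fourier_deriv_ofReal {f : ℝ → ℝ} (hf : Integrable f) (hd : Differentiable ℝ f)
    (hf' : Integrable (deriv f)) (ω : ℝ) :
    𝓕 (fun t : ℝ => ((deriv f t : ℝ) : ℂ)) ω =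
      2 * Real.pi * Complex.I * ω * 𝓕 (fun t : ℝ => (f t : ℂ)) ω := by
  have h1 : ∀ t, HasDerivAt (fun t : ℝ => (f t : ℂ)) ((deriv f t : ℝ) : ℂ) t :=
    fun t => (hd t).hasDerivAt.ofReal_comp
  have h2 : (fun t : ℝ => ((deriv f t : ℝ) : ℂ)) = deriv fun t : ℝ => (f t : ℂ) :=
    funext fun t => (h1 t).deriv.symm
  rw [h2, Real.fourier_deriv hf.ofReal (fun t => (h1 t).differentiableAt)
    (by rw [← h2]; exact hf'.ofReal)]
  rfl

/-- The odd weight that turns the spectral norm into a bilinear form in the function minus its second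
derivative and the first derivative. -/
noncomputable def dualWeight (Q : ℝ → ℝ) (ω : ℝ) : ℝ :=
  1 / (ω * (1 + 4 * Real.pi ^ 2 * ω ^ 2) * Q ω)

namespace TwiceDifferentiable

variable {f : ℝ → ℝ}

lemma continuous_deriv (hf : TwiceDifferentiable f) : Continuous (deriv f) := hf.2.continuous

lemma integrable (hf : TwiceDifferentiable f) (hc : HasCompactSupport f) : Integrable f :=
  hf.1.continuous.integrable_of_hasCompactSupport hc

lemma integrable_deriv (hf : TwiceDifferentiable f) (hc : HasCompactSupport f) :
    Integrable (deriv f) :=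
  hf.continuous_deriv.integrable_of_hasCompactSupport hc.deriv

/-- The spectral norm as a bilinear form with the sine transform of the dual weight as kernel. -/
lemma spectralNormSq_eq (hf : TwiceDifferentiable f) (hc : HasCompactSupport f)
    (h2 : Integrable (deriv (deriv f))) {Q : ℝ → ℝ} (hQ : IsSpectralDensity Q)
    (hV : Integrable (dualWeight Q)) :
    spectralNormSq Q f = ENNReal.ofReal (1 / (2 * Real.pi) * ∫ y, deriv f y *
      ∫ x, (f x - deriv (deriv f) x) * sineTransform (dualWeight Q) (x - y)) := by
  set F : ℝ → ℂ := 𝓕 (fun t : ℝ => (f t : ℂ)) with hF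
  have hfi := hf.integrable hc
  have hpi := hf.integrable_deriv hc
  have hgi : Integrable fun x => f x - deriv (deriv f) x := hfi.sub h2
  -- With `p = f'` and `g = f - f''`, this is `Im (p̂ · conj ĝ)`. It is odd in `ω`, hence the odd
  -- weight.
  set J : ℝ → ℝ := fun ω => 2 * Real.pi * ω * (1 + 4 * Real.pi ^ 2 * ω ^ 2) * ‖F ω‖ ^ 2 with hJ
  have hp : ∀ ω, 𝓕 (fun t : ℝ => ((deriv f t : ℝ) : ℂ)) ω = 2 * Real.pi * Complex.I * ω * F ω :=
    fourier_deriv_ofReal hfi hf.1 hpi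
  have hg : ∀ ω, 𝓕 (fun t : ℝ => ((f t - deriv (deriv f) t : ℝ) : ℂ)) ω =
      ((1 + 4 * Real.pi ^ 2 * ω ^ 2 : ℝ) : ℂ) * F ω := by
    intro ω
    have h3 : 𝓕 (fun t : ℝ => ((f t - deriv (deriv f) t : ℝ) : ℂ)) ω =
        F ω - 𝓕 (fun t : ℝ => ((deriv (deriv f) t : ℝ) : ℂ)) ω := by
      simp only [hF, Real.fourier_real_eq_integral_exp_smul]
      rw [← integral_sub (integrable_exp_smul hfi ω) (integrable_exp_smul h2 ω)]
      refine integral_congr_ae (Filter.Eventually.of_forall fun t => ?_)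
      simp only [Complex.ofReal_sub, smul_sub]
    rw [h3, fourier_deriv_ofReal hpi hf.2 h2, hp]
    push_cast
    linear_combination -4 * (Real.pi : ℂ) ^ 2 * (ω : ℂ) ^ 2 * F ω * Complex.I_sq
  obtain ⟨hi, he⟩ := integral_mul_cross_eq (J := J) hV hgi hpi fun ω => by
    have a1 := fourier_ofReal_re hgi ω
    have a2 := fourier_ofReal_im hgi ω
    have a3 := fourier_ofReal_re hpi ω
    have a4 := fourier_ofReal_im hpi ω
    rw [hg] at a1 a2
    rw [hp] at a3 a4
    rw [← a1, ← a3, ← neg_eq_iff_eq_neg.2 a2, ← neg_eq_iff_eq_neg.2 a4]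
    simp only [hJ]
    rw [Complex.sq_norm, Complex.normSq_apply]
    simp only [Complex.mul_re, Complex.mul_im, Complex.ofReal_re, Complex.ofReal_im, Complex.I_re,
      Complex.I_im, Complex.re_ofNat, Complex.im_ofNat]
    ring
  have hpt : ∀ᵐ ω, ‖F ω‖ ^ 2 / Q ω = 1 / (2 * Real.pi) * (dualWeight Q ω * J ω) := by
    filter_upwards [Measure.ae_ne volume (0 : ℝ)] with ω hω
    have h3 := (hQ.pos ω hω).ne'
    have h4 : 1 + 4 * Real.pi ^ 2 * ω ^ 2 ≠ 0 := by positivity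
    have h5 := Real.pi_pos.ne'
    simp only [hJ, dualWeight]
    field_simp
  rw [← he, ← integral_const_mul, ← integral_congr_ae hpt, ofReal_integral_eq_lintegral_ofReal]
  · rfl
  · exact (hi.const_mul _).congr (hpt.mono fun ω h => h.symm)
  · exact Filter.Eventually.of_forall fun ω => div_nonneg (sq_nonneg _) (hQ.nonneg ω)

/-- The bound of the spectral norm by the sine transform of the dual weight. -/
lemma spectralNormSq_le (hf : TwiceDifferentiable f) {a : ℝ} (ha : 0 ≤ a)
    (hs : Function.support f ⊆ Set.Icc 0 a)
    (h2 : Integrable (deriv (deriv f))) {Q : ℝ → ℝ} (hQ : IsSpectralDensity Q)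
    (hV : Integrable (dualWeight Q)) {B : ℝ} (hB : ∀ᵐ x, |f x - deriv (deriv f) x| ≤ B) :
    spectralNormSq Q f ≤ ENNReal.ofReal (1 / (2 * Real.pi) * ((∫ y, |deriv f y|) *
      (B * ∫ z in (-a)..a, |sineTransform (dualWeight Q) z|))) := by
  have hts : tsupport f ⊆ Set.Icc 0 a := closure_minimal hs isClosed_Icc
  have hc : HasCompactSupport f := isCompact_Icc.of_isClosed_subset (isClosed_tsupport f) hts
  rw [hf.spectralNormSq_eq hc h2 hQ hV]
  have h0 : ∀ x, x ∉ Set.Icc 0 a → deriv f x = 0 := fun x hx =>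
    image_eq_zero_of_notMem_tsupport fun h => hx (hts (tsupport_deriv_subset h))
  refine ENNReal.ofReal_le_ofReal (mul_le_mul_of_nonneg_left ((le_abs_self _).trans
    (abs_integral_mul_le (continuous_sineTransform hV) (hf.integrable_deriv hc) ha hB ?_ h0))
    (by positivity))
  intro x hx
  have h1 : f x = 0 := image_eq_zero_of_notMem_tsupport fun h => hx (hts h)
  have h3 : deriv (deriv f) x = 0 := image_eq_zero_of_notMem_tsupport fun h =>
    hx (hts (tsupport_deriv_subset (tsupport_deriv_subset h)))
  rw [h1, h3, sub_zero]

lemma integrable_deriv_deriv_of_ae_bound (hc : HasCompactSupport f) {C : ℝ}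
    (hC : ∀ᵐ t, |deriv (deriv f) t| ≤ C) : Integrable (deriv (deriv f)) := by
  have hK : IsCompact (tsupport f) := hc
  rw [← integrableOn_iff_integrable_of_support_subset (s := tsupport f)]
  · exact IntegrableOn.of_bound hK.measure_lt_top (measurable_deriv _).aestronglyMeasurable C
      (ae_restrict_of_ae hC)
  · exact (subset_tsupport _).trans ((tsupport_deriv_subset).trans tsupport_deriv_subset)

end TwiceDifferentiable

/-! ### The factors of the explicit density -/

lemma integrable_of_integrableOn_Ioi {f : ℝ → ℝ} {c : ℝ} (hf : IntegrableOn f (Set.Ioi 0))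
    (h : ∀ x, f (-x) = c * f x) : Integrable f := by
  have h1 : Integrable ((Set.Ioi 0).indicator f) := (integrable_indicator_iff measurableSet_Ioi).2 hf
  refine (h1.add (h1.comp_neg.const_mul c)).congr ?_
  filter_upwards [Measure.ae_ne volume (0 : ℝ)] with x hx
  rcases lt_or_gt_of_ne hx with h0 | h0
  · have h2 : x ∉ Set.Ioi (0 : ℝ) := h0.not_gt
    have h3 : -x ∈ Set.Ioi (0 : ℝ) := neg_pos.2 h0
    simp only [Pi.add_apply, Set.indicator_of_notMem h2, Set.indicator_of_mem h3, ← h, neg_neg,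
      zero_add]
  · have h2 : -x ∉ Set.Ioi (0 : ℝ) := by simpa using h0.le
    have h3 : x ∈ Set.Ioi (0 : ℝ) := h0
    simp [h2, h3]

lemma log_pi_gt : 1.09 < Real.log Real.pi :=
  (by norm_num : (1.09 : ℝ) < 1.0986122885).trans
    (Real.log_three_gt_d9.trans (Real.log_lt_log (by norm_num) Real.pi_gt_three))

/-- From `1 - 1/x ≤ log x`. The threshold lies just below `log 3`, so the bound serves `log log π`
and `log log a` for `a ≥ 3` alike. -/
lemma log_log_gt {x : ℝ} (hx : 1.0986 ≤ x) : 0.0895 < Real.log x := by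
  have h1 := Real.one_sub_inv_le_log_of_pos (show 0 < x by linarith)
  have h2 : x⁻¹ ≤ (1.0986 : ℝ)⁻¹ := inv_anti₀ (by norm_num) hx
  have h3 : (1.0986 : ℝ)⁻¹ < 0.9105 := by norm_num
  linarith

lemma log_log_pi_gt : 0.0895 < Real.log (Real.log Real.pi) :=
  log_log_gt ((by norm_num : (1.0986 : ℝ) ≤ 1.0986122885).trans
    (Real.log_three_gt_d9.trans (Real.log_lt_log (by norm_num) Real.pi_gt_three)).le)

/-- The factor `log (π + |x|^{-1/2})`. -/
noncomputable def logFactor (x : ℝ) : ℝ := Real.log (Real.pi + |x| ^ (-1 / 2 : ℝ))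

/-- The factor `log (π + |x|^{-1/2}) (log log (π + |x|^{-1/2}))²`. -/
noncomputable def logWeight (x : ℝ) : ℝ := logFactor x * Real.log (logFactor x) ^ 2

/-- The factor `(1 + |x|²/4π²)^{1/4}`. -/
noncomputable def quarticFactor (x : ℝ) : ℝ := (1 + |x| ^ 2 / (4 * Real.pi ^ 2)) ^ (1 / 4 : ℝ)

lemma log_pi_le_logFactor (x : ℝ) : Real.log Real.pi ≤ logFactor x :=
  Real.log_le_log Real.pi_pos (by have := Real.rpow_nonneg (abs_nonneg x) (-1 / 2); linarith)

lemma logFactor_pos (x : ℝ) : 0 < logFactor x := by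
  linarith [log_pi_gt, log_pi_le_logFactor x]

lemma log_log_pi_le (x : ℝ) : Real.log (Real.log Real.pi) ≤ Real.log (logFactor x) :=
  Real.log_le_log (by linarith [log_pi_gt]) (log_pi_le_logFactor x)

lemma log_logFactor_pos (x : ℝ) : 0 < Real.log (logFactor x) := by
  linarith [log_log_pi_gt, log_log_pi_le x]

lemma logWeight_pos (x : ℝ) : 0 < logWeight x :=
  mul_pos (logFactor_pos x) (pow_pos (log_logFactor_pos x) 2)

lemma logFactor_anti {x y : ℝ} (hx : 0 < x) (hxy : x ≤ y) : logFactor y ≤ logFactor x := by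
  have h1 := Real.rpow_le_rpow_of_nonpos hx hxy (show (-1 / 2 : ℝ) ≤ 0 by norm_num)
  have h2 := Real.rpow_nonneg (hx.le.trans hxy) (-1 / 2)
  refine Real.log_le_log ?_ ?_
  · rw [abs_of_pos (hx.trans_le hxy)]; linarith [Real.pi_pos]
  · rw [abs_of_pos hx, abs_of_pos (hx.trans_le hxy)]; linarith

lemma logWeight_anti {x y : ℝ} (hx : 0 < x) (hxy : x ≤ y) : logWeight y ≤ logWeight x := by
  have h1 := logFactor_anti hx hxy
  have h2 := Real.log_le_log (logFactor_pos y) h1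
  have h3 := log_logFactor_pos y
  exact mul_le_mul h1 (pow_le_pow_left₀ h3.le h2 2) (by positivity) (logFactor_pos x).le

/-- Applying `log y ≤ 2√y` at both logarithmic levels costs only one power `x^{-1/2}`, which is
integrable at `0`. -/
lemma logWeight_le {x : ℝ} (hx : 0 < x) : logWeight x ≤ 16 * (Real.pi + x ^ (-1 / 2 : ℝ)) := by
  set u := Real.pi + x ^ (-1 / 2 : ℝ) with hu
  have hu0 : 0 < u := by have := Real.rpow_nonneg hx.le (-1 / 2); linarith [Real.pi_pos]
  have hL : logFactor x = Real.log u := by rw [logFactor, abs_of_pos hx]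
  have key : ∀ y : ℝ, 0 < y → Real.log y ≤ 2 * √y := fun y hy => by
    have h1 := Real.log_le_sub_one_of_pos (Real.sqrt_pos.2 hy)
    rw [Real.log_sqrt hy.le] at h1
    linarith
  have h1 := key u hu0
  have h2 := key _ (logFactor_pos x)
  have h3 := log_logFactor_pos x
  have h4 := logFactor_pos x
  have h5 : Real.log (logFactor x) ^ 2 ≤ 4 * logFactor x := by
    calc _ ≤ (2 * √(logFactor x)) ^ 2 := pow_le_pow_left₀ h3.le h2 2
      _ = _ := by rw [mul_pow, Real.sq_sqrt h4.le]; norm_num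
  have h6 : logFactor x ^ 2 ≤ 4 * u := by
    calc _ ≤ (2 * √u) ^ 2 := pow_le_pow_left₀ h4.le (by rw [hL]; exact h1) 2
      _ = _ := by rw [mul_pow, Real.sq_sqrt hu0.le]; norm_num
  calc logWeight x ≤ logFactor x * (4 * logFactor x) := mul_le_mul_of_nonneg_left h5 h4.le
    _ = 4 * logFactor x ^ 2 := by ring
    _ ≤ 16 * u := by linarith

lemma log_concave {x y w : ℝ} (hx : 0 < x) (hy : 0 < y) (hw : 0 ≤ w) (hw1 : 0 ≤ 1 - w) :
    (1 - w) * Real.log x + w * Real.log y ≤ Real.log ((1 - w) * x + w * y) := by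
  have h := strictConcaveOn_log_Ioi.concaveOn.2 (Set.mem_Ioi.2 hx) (Set.mem_Ioi.2 hy) hw1 hw
    (by ring)
  simpa only [smul_eq_mul] using h

/-- Growth of the logarithmic weight under dilation. -/
lemma logWeight_le_mul {x z : ℝ} (hx : 0 < x) (hxz : x ≤ z) :
    logWeight x ≤ (x / z) ^ (-3 / 2 : ℝ) * logWeight z := by
  have hz : 0 < z := hx.trans_le hxz
  set l := (x / z) ^ (-1 / 2 : ℝ) with hl
  have hl1 : 1 ≤ l := Real.one_le_rpow_of_pos_of_le_one_of_nonpos (by positivity)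
    ((div_le_one hz).2 hxz) (by norm_num)
  have hl0 : 0 < l := by linarith
  have hl3 : (x / z) ^ (-3 / 2 : ℝ) = l ^ 3 := by
    rw [hl, ← Real.rpow_natCast, ← Real.rpow_mul (by positivity)]; norm_num
  set y := z ^ (-1 / 2 : ℝ) with hy
  have hy0 : 0 < y := by positivity
  have hxl : x ^ (-1 / 2 : ℝ) = l * y := by
    rw [hl, hy, ← Real.mul_rpow (by positivity) hz.le, div_mul_cancel₀ _ hz.ne']
  have hLx : logFactor x = Real.log (Real.pi + l * y) := by rw [logFactor, abs_of_pos hx, hxl]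
  have hLz : logFactor z = Real.log (Real.pi + y) := by rw [logFactor, abs_of_pos hz]
  have hi : 0 ≤ 1 - l⁻¹ := sub_nonneg.2 (inv_le_one_of_one_le₀ hl1)
  have hp := log_pi_gt
  have hpp := log_log_pi_gt
  have hli : 0 ≤ l⁻¹ := by positivity
  have h1 := log_concave Real.pi_pos (show 0 < Real.pi + l * y by positivity) hli hi
  -- Concavity at this convex combination, after dropping the nonnegative `log π` term, gives `log
  -- (π + l y) ≤ l log (π + y)`. The second logarithm is treated the same way, with `log log π > 0`.
  have he : (1 - l⁻¹) * Real.pi + l⁻¹ * (Real.pi + l * y) = Real.pi + y := by field_simp; ring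
  rw [he, ← hLx, ← hLz] at h1
  have hL0 := logFactor_pos x
  have h2 : logFactor x ≤ l * logFactor z := by
    have : l⁻¹ * logFactor x ≤ logFactor z := by
      linarith [mul_nonneg hi (by linarith : 0 ≤ Real.log Real.pi)]
    rwa [inv_mul_le_iff₀ hl0] at this
  have h3 := log_concave (show 0 < Real.log Real.pi by linarith) hL0 hli hi
  have h4 := Real.log_le_log (by
    have := mul_nonneg hi (by linarith : 0 ≤ Real.log Real.pi)
    have : 0 < l⁻¹ * logFactor x := by positivity
    linarith) h1
  have h5 : Real.log (logFactor x) ≤ l * Real.log (logFactor z) := by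
    have : l⁻¹ * Real.log (logFactor x) ≤ Real.log (logFactor z) := by
      have := mul_nonneg hi (by linarith : 0 ≤ Real.log (Real.log Real.pi))
      linarith
    rwa [inv_mul_le_iff₀ hl0] at this
  have h6 := log_logFactor_pos x
  rw [hl3]
  calc logWeight x ≤ (l * logFactor z) * (l * Real.log (logFactor z)) ^ 2 :=
        mul_le_mul h2 (pow_le_pow_left₀ h6.le h5 2) (by positivity) (hL0.le.trans h2)
    _ = l ^ 3 * logWeight z := by rw [logWeight]; ring

/-- The value of the logarithmic weight at scale `1/a`, for `a ≥ 3`. -/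
lemma logWeight_inv_le {a : ℝ} (ha : 3 ≤ a) :
    logWeight a⁻¹ ≤ 2 * Real.log a * (8.75 * Real.log (Real.log a)) ^ 2 := by
  have ha0 : 0 < a := by linarith
  have hla : 1.0986 ≤ Real.log a :=
    (by norm_num : (1.0986 : ℝ) ≤ 1.0986122885).trans (Real.log_three_gt_d9.le.trans
      (Real.log_le_log (by norm_num) ha))
  have hlla := log_log_gt hla
  have hsq : (a⁻¹) ^ (-1 / 2 : ℝ) ≤ a := by
    rw [Real.inv_rpow ha0.le, ← Real.rpow_neg ha0.le]
    calc a ^ (-(-1 / 2) : ℝ) ≤ a ^ (1 : ℝ) :=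
          Real.rpow_le_rpow_of_exponent_le (by linarith) (by norm_num)
      _ = a := Real.rpow_one a
  have h1 : logFactor a⁻¹ ≤ 2 * Real.log a := by
    rw [logFactor, abs_of_pos (inv_pos.2 ha0)]
    have : (2 : ℝ) * Real.log a = Real.log (a ^ 2) := by rw [Real.log_pow]; norm_num
    rw [this]
    refine Real.log_le_log (by positivity) ?_
    -- `π + √a ≤ 4 + a ≤ a²` once `a ≥ 3`.
    nlinarith [Real.pi_lt_four]
  have h2 : Real.log (logFactor a⁻¹) ≤ 8.75 * Real.log (Real.log a) := by
    have h3 := Real.log_le_log (logFactor_pos a⁻¹) h1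
    rw [Real.log_mul (by norm_num) (by linarith)] at h3
    -- `log 2 < 7.75 · 0.0895` absorbs the additive `log 2` into `7.75 log log a`; hence `8.75`.
    linarith [Real.log_two_lt_d9]
  exact mul_le_mul h1 (pow_le_pow_left₀ (log_logFactor_pos _).le h2 2) (by positivity)
    (by linarith)

lemma quarticFactor_pos (x : ℝ) : 0 < quarticFactor x := by unfold quarticFactor; positivity

lemma quarticFactor_pow_four (x : ℝ) : quarticFactor x ^ 4 = 1 + x ^ 2 / (4 * Real.pi ^ 2) := by
  rw [quarticFactor, ← Real.rpow_natCast, ← Real.rpow_mul (by positivity), sq_abs]; norm_num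

lemma one_le_quarticFactor (x : ℝ) : 1 ≤ quarticFactor x :=
  Real.one_le_rpow (le_add_of_nonneg_right (by positivity)) (by norm_num)

lemma quarticFactor_mono {x y : ℝ} (hx : 0 ≤ x) (hxy : x ≤ y) :
    quarticFactor x ≤ quarticFactor y := by
  refine le_of_pow_le_pow_left₀ (n := 4) (by norm_num) (quarticFactor_pos y).le ?_
  rw [quarticFactor_pow_four, quarticFactor_pow_four]
  gcongr

lemma sqrt_le_quarticFactor {x : ℝ} (hx : 0 ≤ x) : √x ≤ 2 * Real.pi * quarticFactor x := by
  have hb := quarticFactor_pos x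
  refine le_of_pow_le_pow_left₀ (n := 4) (by norm_num) (by positivity) ?_
  have h1 : √x ^ 4 = x ^ 2 := by
    rw [show √x ^ 4 = (√x ^ 2) ^ 2 by ring, Real.sq_sqrt hx]
  rw [h1, mul_pow, quarticFactor_pow_four]
  have h3 : (2 * Real.pi) ^ 4 = (4 * Real.pi ^ 2) * (4 * Real.pi ^ 2) := by ring
  have h4 : 1 ≤ 4 * Real.pi ^ 2 := by nlinarith [Real.pi_gt_three]
  have h5 : (4 * Real.pi ^ 2) * (4 * Real.pi ^ 2) * (1 + x ^ 2 / (4 * Real.pi ^ 2)) =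
      (4 * Real.pi ^ 2) ^ 2 + 4 * Real.pi ^ 2 * x ^ 2 := by
    have := Real.pi_pos
    field_simp
  rw [h3, h5]
  nlinarith [mul_nonneg (by linarith : 0 ≤ 4 * Real.pi ^ 2 - 1) (sq_nonneg x)]

lemma quarticFactor_le_two_mul {x : ℝ} (hx : 1 ≤ x) : quarticFactor x ≤ 2 * x := by
  refine le_of_pow_le_pow_left₀ (n := 4) (by norm_num) (by positivity) ?_
  rw [quarticFactor_pow_four]
  have h4 : 1 ≤ 4 * Real.pi ^ 2 := by nlinarith [Real.pi_gt_three]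
  have h5 : x ^ 2 / (4 * Real.pi ^ 2) ≤ x ^ 2 := div_le_self (by positivity) h4
  have h6 : 1 ≤ x ^ 2 := by nlinarith
  nlinarith [mul_nonneg (by linarith : 0 ≤ x ^ 2 - 1) (sq_nonneg x)]

/-- The constant in the numerator of the density. -/
noncomputable def densityConst : ℝ := 1 / 4 * Real.log (Real.log Real.pi)

lemma densityConst_pos : 0 < densityConst := by
  unfold densityConst; linarith [log_log_pi_gt]

lemma horizonFreeDensity_eq (x : ℝ) :
    horizonFreeDensity x = densityConst / (|x| * quarticFactor x * logWeight x) := by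
  rw [logWeight, ← mul_assoc]; rfl

lemma horizonFreeDensity_pos {x : ℝ} (hx : x ≠ 0) : 0 < horizonFreeDensity x := by
  rw [horizonFreeDensity_eq]
  have := quarticFactor_pos x
  have := logWeight_pos x
  have := densityConst_pos
  have := abs_pos.2 hx
  positivity

lemma horizonFreeDensity_nonneg (x : ℝ) : 0 ≤ horizonFreeDensity x := by
  rcases eq_or_ne x 0 with rfl | hx
  · simp [horizonFreeDensity]
  · exact (horizonFreeDensity_pos hx).le

lemma horizonFreeDensity_neg (x : ℝ) : horizonFreeDensity (-x) = horizonFreeDensity x := by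
  simp [horizonFreeDensity]

lemma measurable_horizonFreeDensity : Measurable horizonFreeDensity := by
  unfold horizonFreeDensity
  fun_prop

/-- The factor `1 + (x/2π)²` is the fourth power of `quarticFactor`, and `Q` cancels one power. Both
monotonicity and the `x^{-3/2}` tail bound can be read off. -/
lemma densityRatio_eq {x : ℝ} (hx : 0 < x) : densityRatio horizonFreeDensity 1 x =
    2 * Real.pi / densityConst * (logWeight x / quarticFactor x ^ 3) := by
  have h1 := quarticFactor_pos x
  have h2 := logWeight_pos x
  have h3 := densityConst_pos
  have h4 : 1 + (x / (2 * Real.pi)) ^ (2 * 1) = quarticFactor x ^ 4 := by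
    rw [quarticFactor_pow_four]; congr 1; rw [div_pow]; ring
  rw [densityRatio, h4, horizonFreeDensity_eq, abs_of_pos hx]
  field_simp

lemma dualWeight_eq {x : ℝ} (hx : 0 < x) : dualWeight horizonFreeDensity x =
    1 / densityConst * (logWeight x * (quarticFactor x / (1 + 4 * Real.pi ^ 2 * x ^ 2))) := by
  have h1 := quarticFactor_pos x
  have h2 := logWeight_pos x
  have h3 := densityConst_pos
  have h4 : 0 < 1 + 4 * Real.pi ^ 2 * x ^ 2 := by positivity
  rw [dualWeight, horizonFreeDensity_eq, abs_of_pos hx]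
  field_simp

/-- The Fourier convention produces `(2πx)²` where `R` has `(x/2π)²`. The correcting quotient is
nonincreasing and at most one, so monotonicity and integrability pass from `R` to the dual weight.
-/
lemma dualWeight_eq_mul {x : ℝ} (hx : 0 < x) : dualWeight horizonFreeDensity x =
    1 / (2 * Real.pi) * densityRatio horizonFreeDensity 1 x *
      ((1 + x ^ 2 / (4 * Real.pi ^ 2)) / (1 + 4 * Real.pi ^ 2 * x ^ 2)) := by
  have h1 := quarticFactor_pos x
  have h3 := densityConst_pos
  have h4 : 0 < 1 + 4 * Real.pi ^ 2 * x ^ 2 := by positivity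
  rw [dualWeight_eq hx, densityRatio_eq hx, ← quarticFactor_pow_four]
  have := Real.pi_pos
  field_simp

/-! ### Monotonicity and integrability -/

lemma antitoneOn_densityRatio :
    AntitoneOn (densityRatio horizonFreeDensity 1) (Set.Ioi 0) := by
  intro x hx y hy hxy
  rw [densityRatio_eq hx, densityRatio_eq hy]
  have h1 := quarticFactor_pos x
  have h3 := densityConst_pos
  have h4 := Real.pi_pos
  refine mul_le_mul_of_nonneg_left ?_ (by positivity)
  exact div_le_div₀ (logWeight_pos x).le (logWeight_anti hx hxy) (by positivity)
    (pow_le_pow_left₀ h1.le (quarticFactor_mono (le_of_lt hx) hxy) 3)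

lemma densityRatio_pos {x : ℝ} (hx : 0 < x) : 0 < densityRatio horizonFreeDensity 1 x := by
  rw [densityRatio_eq hx]
  have h1 := quarticFactor_pos x
  have h2 := logWeight_pos x
  have h3 := densityConst_pos
  have h4 := Real.pi_pos
  positivity

lemma densityRatio_neg (x : ℝ) :
    densityRatio horizonFreeDensity 1 (-x) = -1 * densityRatio horizonFreeDensity 1 x := by
  have e : (-x / (2 * Real.pi)) ^ (2 * 1) = (x / (2 * Real.pi)) ^ (2 * 1) := by ring
  rw [densityRatio, densityRatio, horizonFreeDensity_neg, e, neg_mul, neg_mul, div_neg, neg_one_mul]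

lemma measurable_densityRatio : Measurable (densityRatio horizonFreeDensity 1) := by
  have := measurable_horizonFreeDensity
  unfold densityRatio
  fun_prop

lemma integrable_densityRatio : Integrable (densityRatio horizonFreeDensity 1) := by
  refine integrable_of_integrableOn_Ioi ?_ densityRatio_neg
  have hC := densityConst_pos
  have hpi := Real.pi_pos
  have hb : ∀ x : ℝ, 0 < x → ‖densityRatio horizonFreeDensity 1 x‖ ≤
      2 * Real.pi / densityConst * (16 * (Real.pi + x ^ (-1 / 2 : ℝ)) / quarticFactor x ^ 3) := by
    intro x hx
    rw [Real.norm_of_nonneg (densityRatio_pos hx).le, densityRatio_eq hx]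
    have h1 := quarticFactor_pos x
    exact mul_le_mul_of_nonneg_left
      (div_le_div_of_nonneg_right (logWeight_le hx) (by positivity)) (by positivity)
  rw [← Set.Ioc_union_Ioi_eq_Ioi zero_le_one]
  refine IntegrableOn.union ?_ ?_
  · have h1 : IntegrableOn (fun x : ℝ => 2 * Real.pi / densityConst *
        (16 * (Real.pi + x ^ (-1 / 2 : ℝ)))) (Set.Ioc 0 1) := by
      refine Integrable.const_mul (Integrable.const_mul (Integrable.add (integrable_const _) ?_) _) _
      exact (intervalIntegrable_iff_integrableOn_Ioc_of_le zero_le_one).1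
        (intervalIntegral.intervalIntegrable_rpow' (by norm_num))
    refine Integrable.mono' h1 measurable_densityRatio.aestronglyMeasurable ?_
    filter_upwards [ae_restrict_mem measurableSet_Ioc] with x hx
    refine (hb x hx.1).trans (mul_le_mul_of_nonneg_left (div_le_self ?_ ?_) (by positivity))
    · have := Real.rpow_nonneg hx.1.le (-1 / 2); positivity
    · exact one_le_pow₀ (one_le_quarticFactor x)
  · have h1 : IntegrableOn (fun x : ℝ => 2 * Real.pi / densityConst *
        (16 * (Real.pi + 1) * (2 * Real.pi) ^ 3) * x ^ (-3 / 2 : ℝ)) (Set.Ioi 1) :=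
      (integrableOn_Ioi_rpow_of_lt (by norm_num) one_pos).const_mul _
    refine Integrable.mono' h1 measurable_densityRatio.aestronglyMeasurable ?_
    filter_upwards [ae_restrict_mem measurableSet_Ioi] with x hx
    have hx1 : (1 : ℝ) < x := hx
    have hx0 : (0 : ℝ) < x := by linarith
    refine (hb x hx0).trans ?_
    rw [mul_assoc (2 * Real.pi / densityConst)]
    refine mul_le_mul_of_nonneg_left ?_ (by positivity)
    have h2 : x ^ (-1 / 2 : ℝ) ≤ 1 := Real.rpow_le_one_of_one_le_of_nonpos hx1.le (by norm_num)
    have h3 : x ^ (-3 / 2 : ℝ) = (√x ^ 3)⁻¹ := by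
      rw [Real.sqrt_eq_rpow, ← Real.rpow_natCast, ← Real.rpow_mul hx0.le, ← Real.rpow_neg hx0.le]
      norm_num
    have h4 : √x ^ 3 ≤ (2 * Real.pi) ^ 3 * quarticFactor x ^ 3 := by
      rw [← mul_pow]
      exact pow_le_pow_left₀ (Real.sqrt_nonneg x) (sqrt_le_quarticFactor hx0.le) 3
    have h5 := quarticFactor_pos x
    have h6 := Real.sqrt_pos.2 hx0
    rw [h3, ← div_eq_mul_inv, div_le_div_iff₀ (by positivity) (by positivity)]
    calc 16 * (Real.pi + x ^ (-1 / 2 : ℝ)) * √x ^ 3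
        ≤ 16 * (Real.pi + 1) * ((2 * Real.pi) ^ 3 * quarticFactor x ^ 3) := by gcongr
      _ = _ := by ring

lemma weightRatio_anti {x y : ℝ} (hx : 0 < x) (hxy : x ≤ y) :
    (1 + y ^ 2 / (4 * Real.pi ^ 2)) / (1 + 4 * Real.pi ^ 2 * y ^ 2) ≤
      (1 + x ^ 2 / (4 * Real.pi ^ 2)) / (1 + 4 * Real.pi ^ 2 * x ^ 2) := by
  have h4 : 1 ≤ 4 * Real.pi ^ 2 := by nlinarith [Real.pi_gt_three]
  have h5 : (4 * Real.pi ^ 2)⁻¹ ≤ 1 := inv_le_one_of_one_le₀ h4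
  have h6 : x ^ 2 ≤ y ^ 2 := pow_le_pow_left₀ hx.le hxy 2
  rw [div_eq_mul_inv (y ^ 2), div_eq_mul_inv (x ^ 2)]
  set d := 4 * Real.pi ^ 2
  set e := d⁻¹
  have he : 0 ≤ e := by positivity
  rw [div_le_div_iff₀ (by positivity) (by positivity)]
  nlinarith [mul_nonneg (sub_nonneg.2 h6) (by linarith : 0 ≤ d - e)]

lemma weightRatio_le_one (x : ℝ) :
    (1 + x ^ 2 / (4 * Real.pi ^ 2)) / (1 + 4 * Real.pi ^ 2 * x ^ 2) ≤ 1 := by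
  have h4 : 1 ≤ 4 * Real.pi ^ 2 := by nlinarith [Real.pi_gt_three]
  have h5 : x ^ 2 / (4 * Real.pi ^ 2) ≤ x ^ 2 := div_le_self (by positivity) h4
  rw [div_le_one (by positivity)]
  nlinarith [mul_nonneg (by linarith : 0 ≤ 4 * Real.pi ^ 2 - 1) (sq_nonneg x)]

lemma dualWeight_neg (x : ℝ) :
    dualWeight horizonFreeDensity (-x) = -dualWeight horizonFreeDensity x := by
  rw [dualWeight, dualWeight, horizonFreeDensity_neg, neg_sq, neg_mul, neg_mul, div_neg]

lemma dualWeight_nonneg {x : ℝ} (hx : 0 < x) : 0 ≤ dualWeight horizonFreeDensity x := by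
  have := horizonFreeDensity_nonneg x
  unfold dualWeight
  positivity

lemma antitoneOn_dualWeight : AntitoneOn (dualWeight horizonFreeDensity) (Set.Ioi 0) := by
  intro x hx y hy hxy
  rw [dualWeight_eq_mul hx, dualWeight_eq_mul hy]
  have h4 := Real.pi_pos
  have h1 := densityRatio_pos hx
  refine mul_le_mul ?_ (weightRatio_anti hx hxy) (by positivity) (by positivity)
  exact mul_le_mul_of_nonneg_left (antitoneOn_densityRatio hx hy hxy) (by positivity)

lemma integrable_dualWeight : Integrable (dualWeight horizonFreeDensity) := by
  refine integrable_of_integrableOn_Ioi (c := -1) ?_ fun x => by rw [dualWeight_neg, neg_one_mul]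
  have hm : Measurable (dualWeight horizonFreeDensity) := by
    have := measurable_horizonFreeDensity
    unfold dualWeight
    fun_prop
  refine Integrable.mono' (integrable_densityRatio.const_mul (1 / (2 * Real.pi))).integrableOn
    hm.aestronglyMeasurable ?_
  filter_upwards [ae_restrict_mem measurableSet_Ioi] with x hx
  have h4 := Real.pi_pos
  have h1 := densityRatio_pos hx
  rw [Real.norm_of_nonneg (dualWeight_nonneg hx), dualWeight_eq_mul hx]
  exact mul_le_of_le_one_right (by positivity) (weightRatio_le_one x)

/-! ### Integrability and total mass of the density -/

/-- A primitive that dominates the density on the positive half line. -/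
noncomputable def densityPrimitive (x : ℝ) : ℝ :=
  -- The value `0` is the right limit at the origin. The bare formula would use `0 ^ (-1/2) = 0` and
  -- be discontinuous there.
  if x ≤ 0 then 0 else (Real.log (Real.log (Real.pi + x ^ (-1 / 2 : ℝ))))⁻¹

/-- The derivative of `densityPrimitive`. -/
noncomputable def densityMajorant (x : ℝ) : ℝ :=
  1 / 2 * x ^ (-3 / 2 : ℝ) / ((Real.pi + x ^ (-1 / 2 : ℝ)) * logWeight x)

lemma hasDerivAt_densityPrimitive {x : ℝ} (hx : 0 < x) :
    HasDerivAt densityPrimitive (densityMajorant x) x := by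
  have hu : 0 < Real.pi + x ^ (-1 / 2 : ℝ) := by
    have := Real.rpow_nonneg hx.le (-1 / 2); linarith [Real.pi_pos]
  have hL : logFactor x = Real.log (Real.pi + x ^ (-1 / 2 : ℝ)) := by rw [logFactor, abs_of_pos hx]
  have h1 := logFactor_pos x
  have h2 := log_logFactor_pos x
  have hW : logWeight x = logFactor x * Real.log (logFactor x) ^ 2 := rfl
  rw [hL] at h1 h2 hW
  have h3 := (Real.hasDerivAt_rpow_const (p := (-1 / 2 : ℝ)) (Or.inl hx.ne')).const_add Real.pi
  have h4 := ((h3.log hu.ne').log h1.ne').inv h2.ne'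
  have h5 : densityPrimitive =ᶠ[nhds x]
      fun x => (Real.log (Real.log (Real.pi + x ^ (-1 / 2 : ℝ))))⁻¹ := by
    filter_upwards [lt_mem_nhds hx] with y hy
    rw [densityPrimitive, if_neg hy.not_ge]
  refine (h4.congr_of_eventuallyEq h5).congr_deriv ?_
  rw [densityMajorant, hW, show (-1 / 2 - 1 : ℝ) = -3 / 2 by norm_num]
  field_simp

lemma tendsto_densityPrimitive_atTop : Filter.Tendsto densityPrimitive Filter.atTop
    (nhds (Real.log (Real.log Real.pi))⁻¹) := by
  have h1 : Filter.Tendsto (fun x : ℝ => Real.pi + x ^ (-1 / 2 : ℝ)) Filter.atTop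
      (nhds (Real.pi + 0)) := by
    refine Filter.Tendsto.const_add _ ?_
    have := tendsto_rpow_neg_atTop (show (0 : ℝ) < 1 / 2 by norm_num)
    simpa only [neg_div] using this
  rw [add_zero] at h1
  have hp := log_pi_gt
  have hpp := log_log_pi_gt
  refine (((h1.log Real.pi_pos.ne').log (by linarith)).inv₀ (by linarith)).congr' ?_
  filter_upwards [Filter.eventually_gt_atTop 0] with x hx
  rw [densityPrimitive, if_neg hx.not_ge]

lemma continuousWithinAt_densityPrimitive :
    ContinuousWithinAt densityPrimitive (Set.Ici 0) 0 := by
  rw [← Set.Ioi_insert, continuousWithinAt_insert_self, ContinuousWithinAt]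
  have h0 : densityPrimitive 0 = 0 := by simp [densityPrimitive]
  rw [h0]
  have h1 : Filter.Tendsto (fun x : ℝ => Real.pi + x ^ (-1 / 2 : ℝ)) (nhdsWithin 0 (Set.Ioi 0))
      Filter.atTop :=
    Filter.tendsto_atTop_add_const_left _ _ (tendsto_rpow_neg_nhdsGT_zero (by norm_num))
  refine (tendsto_inv_atTop_zero.comp (Real.tendsto_log_atTop.comp
    (Real.tendsto_log_atTop.comp h1))).congr' ?_
  filter_upwards [self_mem_nhdsWithin] with x hx
  have hx0 : 0 < x := hx
  rw [densityPrimitive, if_neg hx0.not_ge]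
  rfl

lemma densityMajorant_nonneg {x : ℝ} (hx : 0 < x) : 0 ≤ densityMajorant x := by
  have := logWeight_pos x
  have := Real.pi_pos
  unfold densityMajorant
  positivity

/-- The majorant equals `1 / (2x (π√x + 1) logWeight x)`, so everything reduces to `π√x + 1 ≤ (1 +
2π²) quarticFactor x`. -/
lemma horizonFreeDensity_le {x : ℝ} (hx : 0 < x) :
    horizonFreeDensity x ≤ 2 * densityConst * (1 + 2 * Real.pi ^ 2) * densityMajorant x := by
  have h1 := quarticFactor_pos x
  have h2 := logWeight_pos x
  have h3 := densityConst_pos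
  have h4 := Real.pi_pos
  have h5 := Real.sqrt_pos.2 hx
  have h6 := Real.sq_sqrt hx.le
  have e1 : x ^ (-1 / 2 : ℝ) = (√x)⁻¹ := by
    rw [Real.sqrt_eq_rpow, ← Real.rpow_neg hx.le]; norm_num
  have e2 : x ^ (-3 / 2 : ℝ) = (√x ^ 3)⁻¹ := by
    rw [Real.sqrt_eq_rpow, ← Real.rpow_natCast, ← Real.rpow_mul hx.le, ← Real.rpow_neg hx.le]
    norm_num
  have h7 : Real.pi * √x + 1 ≤ (1 + 2 * Real.pi ^ 2) * quarticFactor x := by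
    have := sqrt_le_quarticFactor hx.le
    have := one_le_quarticFactor x
    nlinarith
  rw [horizonFreeDensity_eq, densityMajorant, abs_of_pos hx, e1, e2]
  have e3 : 2 * densityConst * (1 + 2 * Real.pi ^ 2) *
      (1 / 2 * (√x ^ 3)⁻¹ / ((Real.pi + (√x)⁻¹) * logWeight x)) =
      densityConst * (1 + 2 * Real.pi ^ 2) / (√x ^ 2 * (Real.pi * √x + 1) * logWeight x) := by
    field_simp
  rw [e3, h6, div_le_div_iff₀ (by positivity) (by positivity)]
  have h8 := mul_le_mul_of_nonneg_left h7 (by positivity : 0 ≤ densityConst * x * logWeight x)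
  linarith

lemma integrableOn_densityMajorant : IntegrableOn densityMajorant (Set.Ioi 0) :=
  integrableOn_Ioi_deriv_of_nonneg continuousWithinAt_densityPrimitive
    (fun _ hx => hasDerivAt_densityPrimitive hx) (fun _ hx => densityMajorant_nonneg hx)
    tendsto_densityPrimitive_atTop

lemma integral_densityMajorant :
    ∫ x in Set.Ioi 0, densityMajorant x = (Real.log (Real.log Real.pi))⁻¹ := by
  rw [integral_Ioi_of_hasDerivAt_of_nonneg continuousWithinAt_densityPrimitive
    (fun _ hx => hasDerivAt_densityPrimitive hx) (fun _ hx => densityMajorant_nonneg hx)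
    tendsto_densityPrimitive_atTop]
  simp [densityPrimitive]

lemma integrable_horizonFreeDensity : Integrable horizonFreeDensity := by
  refine integrable_of_integrableOn_Ioi (c := 1) ?_
    fun x => by rw [horizonFreeDensity_neg, one_mul]
  refine Integrable.mono' (integrableOn_densityMajorant.const_mul
    (2 * densityConst * (1 + 2 * Real.pi ^ 2)))
    measurable_horizonFreeDensity.aestronglyMeasurable ?_
  filter_upwards [ae_restrict_mem measurableSet_Ioi] with x hx
  rw [Real.norm_of_nonneg (horizonFreeDensity_nonneg x)]
  exact horizonFreeDensity_le hx

lemma integral_horizonFreeDensity_le : ∫ ω, horizonFreeDensity ω ≤ 8 * Real.pi ^ 2 := by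
  have h1 : ∫ ω, horizonFreeDensity ω = 2 * ∫ ω in Set.Ioi 0, horizonFreeDensity ω := by
    rw [← integral_comp_abs]
    congr 1; ext ω
    simp [horizonFreeDensity]
  have h2 : ∫ ω in Set.Ioi 0, horizonFreeDensity ω ≤
      2 * densityConst * (1 + 2 * Real.pi ^ 2) * (Real.log (Real.log Real.pi))⁻¹ := by
    rw [← integral_densityMajorant, ← integral_const_mul]
    exact setIntegral_mono_on integrable_horizonFreeDensity.integrableOn
      (integrableOn_densityMajorant.const_mul _) measurableSet_Ioi
      fun x hx => horizonFreeDensity_le hx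
  -- The normalisation `(1/4) log log π` cancels the mass of the majorant, leaving total mass at
  -- most `1 + 2π²`.
  have h3 : 2 * densityConst * (1 + 2 * Real.pi ^ 2) * (Real.log (Real.log Real.pi))⁻¹ =
      (1 + 2 * Real.pi ^ 2) / 2 := by
    have := log_log_pi_gt
    have : Real.log (Real.log Real.pi) ≠ 0 := by linarith
    rw [densityConst]
    field_simp
    norm_num
  rw [h1]
  nlinarith [Real.pi_gt_three]

lemma isSpectralDensity_horizonFreeDensity : IsSpectralDensity horizonFreeDensity where
  integrable := integrable_horizonFreeDensity
  even := horizonFreeDensity_neg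
  nonneg := horizonFreeDensity_nonneg
  pos _ h := horizonFreeDensity_pos h

/-! ### Frequency splitting and the explicit constant -/

lemma integrableOn_and_setIntegral_le {f g : ℝ → ℝ} {s : Set ℝ} (hs : MeasurableSet s)
    (hf : AEStronglyMeasurable f) (hg : IntegrableOn g s) (h0 : ∀ x ∈ s, 0 ≤ f x)
    (h : ∀ x ∈ s, f x ≤ g x) : IntegrableOn f s ∧ ∫ x in s, f x ≤ ∫ x in s, g x := by
  have h1 : IntegrableOn f s := by
    refine Integrable.mono' hg hf.restrict ?_
    filter_upwards [ae_restrict_mem hs] with x hx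
    rw [Real.norm_of_nonneg (h0 x hx)]
    exact h x hx
  exact ⟨h1, setIntegral_mono_on h1 hg hs h⟩

lemma dualWeight_le {x : ℝ} (hx : 0 < x) :
    dualWeight horizonFreeDensity x ≤ 1 / densityConst * logWeight x := by
  have h1 := quarticFactor_pos x
  have h2 := logWeight_pos x
  have h3 := densityConst_pos
  rw [dualWeight_eq hx]
  refine mul_le_mul_of_nonneg_left (mul_le_of_le_one_right h2.le ?_) (by positivity)
  refine le_trans ?_ (weightRatio_le_one x)
  rw [← quarticFactor_pow_four]
  refine div_le_div_of_nonneg_right ?_ (by positivity)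
  exact le_self_pow₀ (one_le_quarticFactor x) (by norm_num)

lemma dualWeight_le_of_one_le {x : ℝ} (hx : 1 ≤ x) : dualWeight horizonFreeDensity x ≤
    1 / densityConst * logWeight x * (1 / (2 * Real.pi ^ 2 * x)) := by
  have h1 := quarticFactor_pos x
  have h2 := logWeight_pos x
  have h3 := densityConst_pos
  have h4 := Real.pi_pos
  rw [dualWeight_eq (by linarith), mul_assoc (1 / densityConst)]
  refine mul_le_mul_of_nonneg_left (mul_le_mul_of_nonneg_left ?_ h2.le) (by positivity)
  have h5 := quarticFactor_le_two_mul hx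
  rw [div_le_div_iff₀ (by positivity) (by positivity)]
  nlinarith [mul_le_mul_of_nonneg_right h5 (by positivity : 0 ≤ 2 * Real.pi ^ 2 * x)]

lemma one_sub_cos_div_nonneg (a : ℝ) {x : ℝ} (hx : 0 < x) :
    0 ≤ (1 - Real.cos (2 * Real.pi * a * x)) / (2 * Real.pi * x) :=
  div_nonneg (sub_nonneg.2 (Real.cos_le_one _)) (by have := Real.pi_pos; positivity)

lemma one_sub_cos_div_le (a : ℝ) {x : ℝ} (hx : 0 < x) :
    (1 - Real.cos (2 * Real.pi * a * x)) / (2 * Real.pi * x) ≤ 1 / (Real.pi * x) := by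
  have := Real.pi_pos
  rw [div_le_div_iff₀ (by positivity) (by positivity)]
  have : 0 < Real.pi * x := by positivity
  nlinarith [Real.neg_one_le_cos (2 * Real.pi * a * x)]

lemma one_sub_cos_div_le_mul (a : ℝ) {x : ℝ} (hx : 0 < x) :
    (1 - Real.cos (2 * Real.pi * a * x)) / (2 * Real.pi * x) ≤ Real.pi * a ^ 2 * x := by
  have := Real.pi_pos
  rw [div_le_iff₀ (by positivity)]
  linarith [Real.one_sub_sq_div_two_le_cos (x := 2 * Real.pi * a * x)]

/-- The mass of the sine transform of the dual weight on `[0, a]`. -/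
lemma integral_dualWeight_le {a : ℝ} (ha : 3 ≤ a) :
    ∫ x in Set.Ioi 0, dualWeight horizonFreeDensity x *
      ((1 - Real.cos (2 * Real.pi * a * x)) / (2 * Real.pi * x)) ≤
      1 / densityConst * logWeight a⁻¹ *
        (2 * Real.pi + Real.log a / Real.pi + 1 / (2 * Real.pi ^ 3)) := by
  set f : ℝ → ℝ := fun x => dualWeight horizonFreeDensity x *
      ((1 - Real.cos (2 * Real.pi * a * x)) / (2 * Real.pi * x)) with hf
  set K := 1 / densityConst * logWeight a⁻¹ with hK
  have hC := densityConst_pos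
  have hpi := Real.pi_pos
  have hK0 : 0 < K := mul_pos (by positivity) (logWeight_pos _)
  have ha0 : 0 < a := by linarith
  have hai : 0 < a⁻¹ := inv_pos.2 ha0
  have hai1 : a⁻¹ ≤ 1 := inv_le_one_of_one_le₀ (by linarith)
  have hfm : AEStronglyMeasurable f :=
    integrable_dualWeight.aestronglyMeasurable.mul (Measurable.aestronglyMeasurable (by fun_prop))
  have hf0 : ∀ x, 0 < x → 0 ≤ f x := fun x hx =>
    mul_nonneg (dualWeight_nonneg hx) (one_sub_cos_div_nonneg a hx)
  have hVK : ∀ x, a⁻¹ ≤ x → dualWeight horizonFreeDensity x ≤ K := fun x hx =>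
    (dualWeight_le (hai.trans_le hx)).trans
      (mul_le_mul_of_nonneg_left (logWeight_anti hai hx) (by positivity))
  -- low frequencies
  obtain ⟨i1, b1⟩ := integrableOn_and_setIntegral_le (f := f) (s := Set.Ioc 0 a⁻¹)
    (g := fun x => K * Real.pi * a ^ (1 / 2 : ℝ) * x ^ (-1 / 2 : ℝ)) measurableSet_Ioc hfm
    (((intervalIntegrable_iff_integrableOn_Ioc_of_le hai.le).1
      (intervalIntegral.intervalIntegrable_rpow' (by norm_num))).const_mul _)
    (fun x hx => hf0 x hx.1) (fun x hx => by
      have hx0 : 0 < x := hx.1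
      -- Growth `x^{-3/2}` relative to scale `1/a`, against the factor `x` from `1 - cos θ ≤ θ²/2`,
      -- leaves the integrable `x^{-1/2}`.
      have h1 : dualWeight horizonFreeDensity x ≤ K * (x / a⁻¹) ^ (-3 / 2 : ℝ) := by
        refine (dualWeight_le hx0).trans ?_
        rw [hK, mul_assoc, mul_comm (logWeight a⁻¹)]
        exact mul_le_mul_of_nonneg_left (logWeight_le_mul hx0 hx.2) (by positivity)
      refine (mul_le_mul h1 (one_sub_cos_div_le_mul a hx0) (one_sub_cos_div_nonneg a hx0)
        (by positivity)).trans_eq ?_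
      have e1 : (x / a⁻¹) ^ (-3 / 2 : ℝ) = x ^ (-3 / 2 : ℝ) * a ^ (-3 / 2 : ℝ) := by
        rw [div_inv_eq_mul, Real.mul_rpow hx0.le ha0.le]
      have e2 : x ^ (-1 / 2 : ℝ) = x ^ (-3 / 2 : ℝ) * x := by
        rw [← Real.rpow_add_one hx0.ne']; norm_num
      have e3 : a ^ (1 / 2 : ℝ) = a ^ (-3 / 2 : ℝ) * a ^ 2 := by
        rw [← Real.rpow_add_natCast ha0.ne']; norm_num
      rw [e1, e2, e3]
      ring)
  have v1 : ∫ x in Set.Ioc 0 a⁻¹, K * Real.pi * a ^ (1 / 2 : ℝ) * x ^ (-1 / 2 : ℝ) =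
      K * (2 * Real.pi) := by
    rw [integral_const_mul, ← intervalIntegral.integral_of_le hai.le,
      integral_rpow (Or.inl (by norm_num)), show (-1 / 2 + 1 : ℝ) = 1 / 2 by norm_num,
      Real.zero_rpow (by norm_num), Real.inv_rpow ha0.le]
    have : a ^ (1 / 2 : ℝ) ≠ 0 := by positivity
    field_simp
    ring
  -- middle frequencies
  obtain ⟨i2, b2⟩ := integrableOn_and_setIntegral_le (f := f) (s := Set.Ioc a⁻¹ 1)
    (g := fun x => K / Real.pi * x⁻¹) measurableSet_Ioc hfm
    (((intervalIntegrable_iff_integrableOn_Ioc_of_le hai1).1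
      (intervalIntegral.intervalIntegrable_inv (fun x hx => by
        rw [Set.uIcc_of_le hai1] at hx
        exact (hai.trans_le hx.1).ne') continuousOn_id)).const_mul _)
    (fun x hx => hf0 x (hai.trans hx.1)) (fun x hx => by
      have hx0 : 0 < x := hai.trans hx.1
      refine (mul_le_mul (hVK x hx.1.le) (one_sub_cos_div_le a hx0)
        (one_sub_cos_div_nonneg a hx0) hK0.le).trans_eq ?_
      field_simp)
  -- Source of the second factor `log a`; the other two ranges contribute only constants times `K`.
  have v2 : ∫ x in Set.Ioc a⁻¹ 1, K / Real.pi * x⁻¹ = K * (Real.log a / Real.pi) := by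
    rw [integral_const_mul, ← intervalIntegral.integral_of_le hai1,
      integral_inv_of_pos hai one_pos, one_div, inv_inv]
    ring
  -- high frequencies
  obtain ⟨i3, b3⟩ := integrableOn_and_setIntegral_le (f := f) (s := Set.Ioi 1)
    (g := fun x => K * (1 / (2 * Real.pi ^ 3)) * x ^ (-2 : ℝ)) measurableSet_Ioi hfm
    ((integrableOn_Ioi_rpow_of_lt (by norm_num) one_pos).const_mul _)
    (fun x hx => hf0 x (one_pos.trans hx)) (fun x hx => by
      have hx1 : 1 < x := hx
      have hx0 : 0 < x := one_pos.trans hx1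
      have h1 : dualWeight horizonFreeDensity x ≤ K * (1 / (2 * Real.pi ^ 2 * x)) := by
        refine (dualWeight_le_of_one_le hx1.le).trans
          (mul_le_mul_of_nonneg_right ?_ (by positivity))
        exact mul_le_mul_of_nonneg_left (logWeight_anti hai (hai1.trans hx1.le)) (by positivity)
      refine (mul_le_mul h1 (one_sub_cos_div_le a hx0) (one_sub_cos_div_nonneg a hx0)
        (by positivity)).trans_eq ?_
      rw [Real.rpow_neg hx0.le, Real.rpow_two]
      field_simp)
  have v3 : ∫ x in Set.Ioi 1, K * (1 / (2 * Real.pi ^ 3)) * x ^ (-2 : ℝ) =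
      K * (1 / (2 * Real.pi ^ 3)) := by
    rw [integral_const_mul, integral_Ioi_rpow_of_lt (by norm_num) one_pos]
    norm_num
  rw [← Set.Ioc_union_Ioi_eq_Ioi hai.le, setIntegral_union Set.Ioc_disjoint_Ioi_same
    measurableSet_Ioi i1 (by rw [← Set.Ioc_union_Ioi_eq_Ioi hai1]; exact i2.union i3),
    ← Set.Ioc_union_Ioi_eq_Ioi hai1, setIntegral_union Set.Ioc_disjoint_Ioi_same
    measurableSet_Ioi i2 i3]
  linarith

/-- The bound of the sine transform of the dual weight with explicit constant. -/
lemma integral_abs_sineTransform_dualWeight_le {a : ℝ} (ha : 3 ≤ a) :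
    1 / (2 * Real.pi) * ∫ z in (-a)..a, |sineTransform (dualWeight horizonFreeDensity) z| ≤
      ((2 * Real.pi * Real.exp 1) ^ 2) ^ 2 * (Real.log a * Real.log (Real.log a)) ^ 2 := by
  rw [integral_abs_sineTransform integrable_dualWeight dualWeight_neg antitoneOn_dualWeight
    (by linarith)]
  have h1 := integral_dualWeight_le ha
  have h2 := logWeight_inv_le ha
  have hC := densityConst_pos
  -- `4 / 0.0895 < 45`.
  have hC' : 1 / densityConst ≤ 45 := by
    rw [div_le_iff₀ hC, densityConst]
    linarith [log_log_pi_gt]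
  have hpi := Real.pi_pos
  have hpi3 := Real.pi_gt_three
  have hW := logWeight_pos a⁻¹
  set la := Real.log a with hla
  have hla1 : 1.0986 ≤ la :=
    (by norm_num : (1.0986 : ℝ) ≤ 1.0986122885).trans (Real.log_three_gt_d9.le.trans
      (Real.log_le_log (by norm_num) ha))
  set I := ∫ x in Set.Ioi 0, dualWeight horizonFreeDensity x *
      ((1 - Real.cos (2 * Real.pi * a * x)) / (2 * Real.pi * x)) with hI
  have h3 : 2 / Real.pi * (2 * Real.pi + la / Real.pi + 1 / (2 * Real.pi ^ 3)) ≤ 4 * la := by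
    have e : 2 / Real.pi * (2 * Real.pi + la / Real.pi + 1 / (2 * Real.pi ^ 3)) =
        4 + 2 * la * (1 / Real.pi ^ 2) + (1 / Real.pi ^ 4) := by field_simp; ring
    have b2 : 1 / Real.pi ^ 2 ≤ 1 / 9 := one_div_le_one_div_of_le (by norm_num) (by nlinarith)
    have b4 : 1 / Real.pi ^ 4 ≤ 1 / 81 := one_div_le_one_div_of_le (by norm_num) (by
      calc (81 : ℝ) = 3 ^ 4 := by norm_num
        _ ≤ Real.pi ^ 4 := pow_le_pow_left₀ (by norm_num) hpi3.le 4)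
    rw [e]
    nlinarith
  -- The accumulated constant is `45 · 2 · 8.75² · 4 = 27562.5`, while `2πe > 16`.
  have h4 : (32000 : ℝ) ≤ ((2 * Real.pi * Real.exp 1) ^ 2) ^ 2 := by
    have h5 : (16 : ℝ) ≤ 2 * Real.pi * Real.exp 1 := by nlinarith [Real.exp_one_gt_d9]
    calc (32000 : ℝ) ≤ (16 ^ 2) ^ 2 := by norm_num
      _ ≤ _ := by gcongr
  calc 1 / (2 * Real.pi) * (4 * I) = 2 / Real.pi * I := by field_simp; norm_num
    _ ≤ 2 / Real.pi * (1 / densityConst * logWeight a⁻¹ *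
        (2 * Real.pi + la / Real.pi + 1 / (2 * Real.pi ^ 3))) :=
      mul_le_mul_of_nonneg_left h1 (by positivity)
    _ = 1 / densityConst * logWeight a⁻¹ *
        (2 / Real.pi * (2 * Real.pi + la / Real.pi + 1 / (2 * Real.pi ^ 3))) := by ring
    _ ≤ 45 * (2 * la * (8.75 * Real.log la) ^ 2) * (4 * la) := by gcongr
    _ = 27562.5 * (la * Real.log la) ^ 2 := by ring
    _ ≤ _ := mul_le_mul_of_nonneg_right (by linarith) (sq_nonneg _)

/-! ### Finiteness of the norm and the final bound -/

/-- The squared norm in the reproducing kernel Hilbert space is at most the spectral one. -/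
lemma IsSpectralDensity.rkhsNormSq_le {Q : ℝ → ℝ} (hQ : IsSpectralDensity Q) {f : ℝ → ℝ}
    (hfc : Continuous f) (hfi : Integrable f) {H : Type*} [NormedAddCommGroup H]
    [InnerProductSpace ℝ H] [CompleteSpace H] [RKHS ℝ H ℝ ℝ]
    (hH : HasReproducingKernel H (spectralKernel Q)) : rkhsNormSq H f ≤ spectralNormSq Q f := by
  by_cases hfin : spectralNormSq Q f = ∞
  · rw [hfin]; exact le_top
  · obtain ⟨g, hg, hn⟩ := hQ.exists_rkhs_norm_eq hfc hfi hfin hH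
    exact (iInf₂_le g hg).trans hn.le

/-- The bilinear identity already writes the norm as `ENNReal.ofReal` of a real number, so no
estimate is needed. -/
lemma spectralNormSq_ne_top {f : ℝ → ℝ} (hf : TwiceDifferentiable f) (hc : HasCompactSupport f)
    {C : ℝ} (hC : ∀ᵐ t, |deriv (deriv f) t| ≤ C) : spectralNormSq horizonFreeDensity f ≠ ∞ := by
  rw [hf.spectralNormSq_eq hc (TwiceDifferentiable.integrable_deriv_deriv_of_ae_bound hc hC)
    isSpectralDensity_horizonFreeDensity integrable_dualWeight]
  exact ENNReal.ofReal_ne_top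

lemma spectralNormSq_ne_top_of_contDiff {f : ℝ → ℝ} (hf : ContDiff ℝ 2 f)
    (hc : HasCompactSupport f) : spectralNormSq horizonFreeDensity f ≠ ∞ := by
  have h1 : ContDiff ℝ 1 (deriv f) := (contDiff_succ_iff_deriv (n := 1).1 hf).2.2
  have h2 : Continuous (deriv (deriv f)) := h1.continuous_deriv le_rfl
  obtain ⟨C, hC⟩ := h2.bounded_above_of_compact_support hc.deriv.deriv
  exact spectralNormSq_ne_top ⟨hf.differentiable (by norm_num), h1.differentiable (by norm_num)⟩ hc
    (Filter.Eventually.of_forall hC)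

lemma spectralNormSq_horizonFreeDensity_le {T : ℝ} (hT : 2 < T) {f : ℝ → ℝ}
    (hf : TwiceDifferentiable f) (hs : Function.support f ⊆ Set.Icc 0 (T + 1)) :
    spectralNormSq horizonFreeDensity f ≤
      ENNReal.ofReal (((2 * Real.pi * Real.exp 1) ^ 2) ^ 2) * eLpNorm (deriv f) 1 volume *
        eLpNorm (fun t => f t - deriv (deriv f) t) ∞ volume *
        ENNReal.ofReal ((Real.log (1 + T) * Real.log (Real.log (1 + T))) ^ 2) := by
  have hc : HasCompactSupport f :=
    isCompact_Icc.of_isClosed_subset (isClosed_tsupport f) (closure_minimal hs isClosed_Icc)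
  have hla : 1.0986 ≤ Real.log (1 + T) :=
    (by norm_num : (1.0986 : ℝ) ≤ 1.0986122885).trans (Real.log_three_gt_d9.le.trans
      (Real.log_le_log (by norm_num) (by linarith)))
  have hlla := log_log_gt hla
  have hlog : 0 < (Real.log (1 + T) * Real.log (Real.log (1 + T))) ^ 2 :=
    pow_pos (mul_pos (by linarith) (by linarith)) 2
  have hpi := Real.pi_pos
  have hA : eLpNorm (deriv f) 1 volume = ENNReal.ofReal (∫ y, |deriv f y|) := by
    rw [eLpNorm_one_eq_lintegral_enorm, ← ofReal_integral_norm_eq_lintegral_enorm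
      (hf.integrable_deriv hc)]
    rfl
  by_cases hB : eLpNorm (fun t => f t - deriv (deriv f) t) ∞ volume = ∞
  -- Here `0 · ∞ = 0` on the right, so `f` itself must vanish: it is constant and `T + 2` lies
  -- outside its support.
  · by_cases hz : eLpNorm (deriv f) 1 volume = 0
    · have h1 : deriv f = 0 := by
        rw [eLpNorm_eq_zero_iff hf.continuous_deriv.aestronglyMeasurable one_ne_zero] at hz
        exact hf.continuous_deriv.ae_eq_iff_eq volume continuous_zero |>.1 hz
      have h2 : f = 0 := funext fun x => by
        rw [is_const_of_deriv_eq_zero hf.1 (fun x => congrFun h1 x) x (T + 2)]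
        exact Function.notMem_support.1 fun h => by linarith [(hs h).2]
      refine le_of_eq_of_le ?_ zero_le
      simp [h2, spectralNormSq, Real.fourier_real_eq_integral_exp_smul]
    · rw [hB, ENNReal.mul_top (mul_ne_zero (ENNReal.ofReal_pos.2 (by positivity)).ne' hz),
        ENNReal.top_mul (ENNReal.ofReal_pos.2 hlog).ne']
      exact le_top
  · set B := (eLpNorm (fun t => f t - deriv (deriv f) t) ∞ volume).toReal with hBd
    have hBe : eLpNorm (fun t => f t - deriv (deriv f) t) ∞ volume = ENNReal.ofReal B :=
      (ENNReal.ofReal_toReal hB).symm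
    have hB0 : 0 ≤ B := ENNReal.toReal_nonneg
    have hgB : ∀ᵐ x, |f x - deriv (deriv f) x| ≤ B := by
      filter_upwards [ae_le_eLpNormEssSup (f := fun t => f t - deriv (deriv f) t)
        (μ := volume)] with x hx
      rw [← eLpNorm_exponent_top, hBe, ← ofReal_norm,
        ENNReal.ofReal_le_ofReal_iff hB0] at hx
      exact hx
    obtain ⟨M, hM⟩ := hf.1.continuous.bounded_above_of_compact_support hc
    -- `f` is bounded and `f - f''` is essentially bounded, so `f''` is essentially bounded with
    -- compact support.
    have h2 : Integrable (deriv (deriv f)) :=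
      TwiceDifferentiable.integrable_deriv_deriv_of_ae_bound (C := B + M) hc (by
        filter_upwards [hgB] with x hx
        have h3 := hM x
        rw [Real.norm_eq_abs] at h3
        rw [abs_le] at hx h3 ⊢
        constructor <;> linarith)
    refine (hf.spectralNormSq_le (by linarith) hs h2 isSpectralDensity_horizonFreeDensity
      integrable_dualWeight hgB).trans ?_
    have hA0 : 0 ≤ ∫ y, |deriv f y| := integral_nonneg fun y => abs_nonneg _
    rw [hA, hBe, ← ENNReal.ofReal_mul (by positivity), ← ENNReal.ofReal_mul (by positivity),
      ← ENNReal.ofReal_mul (by positivity)]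
    refine ENNReal.ofReal_le_ofReal ?_
    have h3 := integral_abs_sineTransform_dualWeight_le (a := T + 1) (by linarith)
    rw [add_comm T 1] at h3 ⊢
    calc _ = (∫ y, |deriv f y|) * B * (1 / (2 * Real.pi) *
          ∫ z in (-(1 + T))..(1 + T), |sineTransform (dualWeight horizonFreeDensity) z|) := by ring
      _ ≤ (∫ y, |deriv f y|) * B * _ := mul_le_mul_of_nonneg_left h3 (by positivity)
      _ = _ := by ring

theorem mainTheorem4 :
    -- the density and the function `R` (order `m = 1`) satisfy the requirements
    (∀ ω, 0 ≤ horizonFreeDensity ω) ∧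
    (∀ ω, ω ≠ 0 → 0 < horizonFreeDensity ω) ∧
    (∀ ω, horizonFreeDensity (-ω) = horizonFreeDensity ω) ∧
    Integrable horizonFreeDensity ∧
    Integrable (densityRatio horizonFreeDensity 1) ∧
    AntitoneOn (densityRatio horizonFreeDensity 1) (Set.Ioi 0) ∧
    -- `k` is a real, positive semidefinite, translation invariant, universal kernel
    (∀ s t, (spectralKernelC horizonFreeDensity s t).im = 0) ∧
    (Matrix.of (spectralKernel horizonFreeDensity)).PosSemidef ∧
    IsTranslationInvariant (spectralKernel horizonFreeDensity) ∧
    IsUniversalKernel (spectralKernel horizonFreeDensity) ∧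
    -- with bounded diagonal
    (∀ t, spectralKernel horizonFreeDensity t t ≤ 8 * Real.pi ^ 2) ∧
    -- its RKHS contains the compactly supported functions with bounded derivatives up to order two,
    -- and there its norm is given by the spectral formula
    (∀ (H : Type*) [NormedAddCommGroup H] [InnerProductSpace ℝ H] [CompleteSpace H]
        [RKHS ℝ H ℝ ℝ],
      HasReproducingKernel H (spectralKernel horizonFreeDensity) →
      ∀ f : ℝ → ℝ, TwiceDifferentiable f → HasCompactSupport f →
        (∃ C : ℝ, ∀ t, |deriv (deriv f) t| ≤ C) →
        ∃ g : H, (⇑g : ℝ → ℝ) = f ∧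
          ENNReal.ofReal (‖g‖ ^ 2) = spectralNormSq horizonFreeDensity f) ∧
    -- the bound, in the RKHS norm and in the norm given by the spectral formula
    (∃ c : ℝ, 0 ≤ c ∧ c ≤ (2 * Real.pi * Real.exp 1) ^ 2 ∧
      ∀ (T : ℝ), 2 < T → ∀ f : ℝ → ℝ, TwiceDifferentiable f →
        Function.support f ⊆ Set.Icc 0 (T + 1) →
        spectralNormSq horizonFreeDensity f ≤
          ENNReal.ofReal (c ^ 2) * eLpNorm (deriv f) 1 volume *
            eLpNorm (fun t => f t - deriv (deriv f) t) ∞ volume *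
            ENNReal.ofReal ((Real.log (1 + T) * Real.log (Real.log (1 + T))) ^ 2) ∧
        ∀ (H : Type*) [NormedAddCommGroup H] [InnerProductSpace ℝ H] [CompleteSpace H]
            [RKHS ℝ H ℝ ℝ],
          HasReproducingKernel H (spectralKernel horizonFreeDensity) →
          rkhsNormSq H f ≤
            ENNReal.ofReal (c ^ 2) * eLpNorm (deriv f) 1 volume *
              eLpNorm (fun t => f t - deriv (deriv f) t) ∞ volume *
              ENNReal.ofReal ((Real.log (1 + T) * Real.log (Real.log (1 + T))) ^ 2)) := by
  have hQ := isSpectralDensity_horizonFreeDensity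
  refine ⟨horizonFreeDensity_nonneg, fun _ h => horizonFreeDensity_pos h, horizonFreeDensity_neg,
    integrable_horizonFreeDensity, integrable_densityRatio, antitoneOn_densityRatio,
    hQ.spectralKernelC_im, hQ.posSemidef,
    IsSpectralDensity.isTranslationInvariant horizonFreeDensity,
    hQ.isUniversalKernel fun f => spectralNormSq_ne_top_of_contDiff, fun t => ?_, ?_,
    (2 * Real.pi * Real.exp 1) ^ 2, sq_nonneg _, le_rfl, ?_⟩
  · rw [hQ.spectralKernel_self]
    exact integral_horizonFreeDensity_le
  · rintro H _ _ _ _ hH f hf hc ⟨C, hC⟩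
    exact hQ.exists_rkhs_norm_eq hf.1.continuous (hf.integrable hc)
      (spectralNormSq_ne_top hf hc (Filter.Eventually.of_forall hC)) hH
  · intro T hT f hf hs
    have h := spectralNormSq_horizonFreeDensity_le hT hf hs
    refine ⟨h, ?_⟩
    intro H _ _ _ _ hH
    have hc : HasCompactSupport f :=
      isCompact_Icc.of_isClosed_subset (isClosed_tsupport f) (closure_minimal hs isClosed_Icc)
    exact (hQ.rkhsNormSq_le hf.1.continuous (hf.integrable hc) hH).trans h
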